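/- Let $G=(\mathcal V,\mathcal E,s,r)$ be a directed graph with finitely many vertices; loops, multiple edges, and infinitely many (possibly uncountably many) edges are allowed. Assume that $G$ is strongly connected, i.e. for all $x,y\in\mathcal V$ there is a directed path (possibly of length zero) from $x$ to $y$. Let $\mathbb F_G^+$ be the set of all directed paths of finite length in $G$, the vertices being the paths of length zero, and let $\mathcal H_G=\ell^2(\mathbb F_G^+)$ have the standard orthonormal basis $\{\xi_w : w\in\mathbb F_G^+\}$. For $e\in\mathcal E$ and $x\in\mathcal V$ define bounded operators on $\mathcal H_G$ by $$L_e\xi_w=\begin{cases}\xi_{ew}& r(w)=s(e)\\ 0&\text{otherwise,}\end{cases}\qquad L_x\xi_w=\begin{cases}\xi_{w}& r(w)=x\\ 0&\text{otherwise,}\end{cases}$$ where $ew$ is the path that runs first through $w$ and then through $e$. Let $\mathcal A_G$ (the tensor algebra) and $\mathfrak L_G$ (the left free semigroupoid algebra) be, respectively, the norm closure and the weak-operator closure of the algebra generated by $\{L_e,L_x : e\in\mathcal E,\ x\in\mathcal V\}$, both with the operator norm. Then every bounded derivation from $\mathcal A_G$ into $\mathfrak L_G$ is inner: if $\delta:\mathcal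 A_G\to\mathfrak L_G$ is a bounded linear map with $\delta(AB)=\delta(A)B+A\delta(B)$ for all $A,B\in\mathcal A_G$, then there is $T\in\mathfrak L_G$ such that $\delta(A)=AT-TA$ for all $A\in\mathcal A_G$. -/

import Mathlib

/-!
Free semigroupoid algebras. A directed graph is a quiver `V`: the vertices are the elements of `V`,
an edge `e` with source `x` and range `y` is an element of `x ⟶ y`. Loops, multiple edges and
arbitrary (also uncountable) sets of edges are allowed.
-/

namespace FreeSemigroupoid

section Paths

/-- The free semigroupoid of a directed graph: all directed paths of finite length, a path with
source `x` and range `y` being an element of `Quiver.Path x y`. The paths of length zero are the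
vertices. -/
abbrev PathSpace (V : Type*) [Quiver V] : Type _ :=
  Σ x : V, Σ y : V, Quiver.Path x y

variable {V : Type*} [Quiver V]

/-- The source of a path. -/
def PathSpace.source (w : PathSpace V) : V := w.1

/-- The range of a path. -/
def PathSpace.range (w : PathSpace V) : V := w.2.1

/-- The product `e w` of an edge `e` from `x` to `y` with a path `w` whose range is `x`: the path
that first runs through `w` and then through `e`. -/
def edgeMul {x y : V} (e : x ⟶ y) (w : {w : PathSpace V // w.range = x}) : PathSpace V :=
  ⟨w.1.1, y, w.1.2.2.cons (cast (congrArg (fun z => (z ⟶ y)) w.2.symm) e)⟩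

theorem edgeMul_mk {u x y : V} (e : x ⟶ y) (p : Quiver.Path u x) :
    edgeMul e ⟨⟨u, x, p⟩, rfl⟩ = ⟨u, y, p.cons e⟩ := rfl

theorem edgeMul_injective {x y : V} (e : x ⟶ y) : Function.Injective (edgeMul e) := by
  rintro ⟨⟨u, x', p⟩, h⟩ ⟨⟨u', x'', p'⟩, h'⟩ heq
  change x' = x at h
  change x'' = x at h'
  subst h
  subst h'
  rw [edgeMul_mk, edgeMul_mk] at heq
  obtain ⟨rfl, h2⟩ := Sigma.mk.inj heq
  have h3 := eq_of_heq (Sigma.mk.inj (eq_of_heq h2)).2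
  rw [Quiver.Path.cons.injEq] at h3
  obtain rfl := eq_of_heq h3.2.1
  rfl

end Paths

noncomputable section Operators

open scoped lp

/-- The operator on `ℓ²(ι)` attached to an injective map `g` from a subset `s` of `ι` to `ι`: it
maps the basis vector at `w` to the basis vector at `g w` if `w ∈ s`, and to `0` otherwise. In
coordinates, the value of `T f` at `g w` is `f w`, and it is `0` off the image of `g`. -/
def partialShift {ι : Type*} {s : Set ι} (g : s → ι) (hg : Function.Injective g) :
    ℓ²(ι, ℂ) →L[ℂ] ℓ²(ι, ℂ) :=
  have key (f : ℓ²(ι, ℂ)) : (fun w => ‖Function.extend g (fun u : s => f u) 0 w‖ ^ 2) =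
      Function.extend g (fun u : s => ‖f u‖ ^ 2) 0 := by
    funext w
    by_cases hw : ∃ u, g u = w
    · obtain ⟨u, rfl⟩ := hw
      rw [hg.extend_apply, hg.extend_apply]
    · rw [Function.extend_apply' _ _ _ hw, Function.extend_apply' _ _ _ hw]
      simp
  have sumf (f : ℓ²(ι, ℂ)) : Summable fun i => ‖f i‖ ^ 2 := by
    simpa using (lp.memℓp f).summable (by norm_num)
  have sums (f : ℓ²(ι, ℂ)) : Summable fun u : s => ‖f u‖ ^ 2 := (sumf f).subtype s
  have mem (f : ℓ²(ι, ℂ)) : Memℓp (Function.extend g (fun u : s => f u) 0) 2 := by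
    refine memℓp_gen ?_
    have := (summable_extend_zero hg).2 (sums f)
    simpa [key f] using this
  LinearMap.mkContinuous
    { toFun := fun f => ⟨Function.extend g (fun u : s => f u) 0, mem f⟩
      map_add' := fun f f' => by
        ext w
        change Function.extend g (fun u : s => f u + f' u) 0 w =
          Function.extend g (fun u : s => f u) 0 w + Function.extend g (fun u : s => f' u) 0 w
        by_cases hw : ∃ u, g u = w
        · obtain ⟨u, rfl⟩ := hw
          simp only [hg.extend_apply]
        · simp [Function.extend_apply' _ _ _ hw]
      map_smul' := fun c f => by
        ext w
        by_cases hw : ∃ u, g u = w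
        · obtain ⟨u, rfl⟩ := hw
          simp [hg.extend_apply]
        · simp [Function.extend_apply' _ _ _ hw] }
    1 (fun f => by
      rw [one_mul]
      refine le_of_sq_le_sq ?_ (norm_nonneg _)
      have h1 (h : ℓ²(ι, ℂ)) : ‖h‖ ^ 2 = ∑' i, ‖h i‖ ^ 2 := by
        simpa using lp.norm_rpow_eq_tsum (p := 2) (by norm_num) h
      rw [h1, h1]
      calc _ = ∑' w, Function.extend g (fun u : s => ‖f u‖ ^ 2) 0 w :=
            tsum_congr fun w => congrFun (key f) w
        _ = ∑' u : s, ‖f u‖ ^ 2 := tsum_extend_zero hg _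
        _ ≤ ∑' i, ‖f i‖ ^ 2 := (sumf f).tsum_subtype_le _ s (fun i => by positivity))

theorem partialShift_coe {ι : Type*} {s : Set ι} (g : s → ι) (hg : Function.Injective g)
    (f : ℓ²(ι, ℂ)) :
    (partialShift g hg f : ι → ℂ) = Function.extend g (fun u : s => f u) 0 := rfl

variable (V : Type*) [Quiver V]

/-- The Hilbert space `ℓ²` of the path space. -/
abbrev PathHilbert : Type _ := ℓ²(PathSpace V, ℂ)

variable {V}

open scoped Classical in
/-- The vector `ξ_w` of the standard orthonormal basis. -/
def basisVec (w : PathSpace V) : PathHilbert V := lp.single 2 w (1 : ℂ)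

/-- The partial isometry `L_e` of an edge: `L_e ξ_w = ξ_{ew}` if the range of `w` is the source of
`e`, and `L_e ξ_w = 0` otherwise. -/
def edgeOp {x y : V} (e : x ⟶ y) : PathHilbert V →L[ℂ] PathHilbert V :=
  partialShift (s := {w | w.range = x}) (edgeMul e) (edgeMul_injective e)

/-- The projection `L_x` of a vertex: `L_x ξ_w = ξ_w` if the range of `w` is `x`, and
`L_x ξ_w = 0` otherwise. -/
def vertexOp (x : V) : PathHilbert V →L[ℂ] PathHilbert V :=
  partialShift (s := {w | w.range = x}) Subtype.val Subtype.val_injective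

theorem partialShift_basisVec_of_mem {s : Set (PathSpace V)} (g : s → PathSpace V)
    (hg : Function.Injective g) (w : s) :
    partialShift g hg (basisVec w.1) = basisVec (g w) := by
  ext v
  rw [partialShift_coe]
  by_cases hv : ∃ u, g u = v
  · obtain ⟨u, rfl⟩ := hv
    classical
    simp only [hg.extend_apply, basisVec, lp.single_apply, Pi.single_apply, hg.eq_iff,
      Subtype.ext_iff]
  · rw [Function.extend_apply' _ _ _ hv]
    have : v ≠ g w := fun h => hv ⟨w, h.symm⟩
    simp [basisVec, this]

theorem partialShift_basisVec_of_notMem {s : Set (PathSpace V)} (g : s → PathSpace V)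
    (hg : Function.Injective g) {w : PathSpace V} (hw : w ∉ s) :
    partialShift g hg (basisVec w) = 0 := by
  ext v
  rw [partialShift_coe]
  by_cases hv : ∃ u, g u = v
  · obtain ⟨u, rfl⟩ := hv
    have : (u : PathSpace V) ≠ w := fun h => hw (h ▸ u.2)
    simp [hg.extend_apply, basisVec, this]
  · rw [Function.extend_apply' _ _ _ hv]
    simp

theorem edgeOp_basisVec {u x y : V} (e : x ⟶ y) (p : Quiver.Path u x) :
    edgeOp e (basisVec ⟨u, x, p⟩) = basisVec ⟨u, y, p.cons e⟩ :=
  partialShift_basisVec_of_mem (s := {w : PathSpace V | w.range = x}) (edgeMul e) _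
    ⟨⟨u, x, p⟩, rfl⟩

theorem edgeOp_basisVec_of_ne {x y : V} (e : x ⟶ y) {w : PathSpace V} (h : w.range ≠ x) :
    edgeOp e (basisVec w) = 0 :=
  partialShift_basisVec_of_notMem _ _ h

theorem vertexOp_basisVec (w : PathSpace V) : vertexOp w.range (basisVec w) = basisVec w :=
  partialShift_basisVec_of_mem (s := {v : PathSpace V | v.range = w.range}) Subtype.val _ ⟨w, rfl⟩

theorem vertexOp_basisVec_of_ne {x : V} {w : PathSpace V} (h : w.range ≠ x) :
    vertexOp x (basisVec w) = 0 :=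
  partialShift_basisVec_of_notMem _ _ h

variable (V)

/-- The generators `L_e`, `L_x` for all edges `e` and all vertices `x`. -/
def generators : Set (PathHilbert V →L[ℂ] PathHilbert V) :=
  {T | ∃ (x y : V) (e : x ⟶ y), T = edgeOp e} ∪ {T | ∃ x : V, T = vertexOp x}

/-- The algebra generated, without any closure, by the operators `L_e` and `L_x`. -/
def algebraicPart : NonUnitalSubalgebra ℂ (PathHilbert V →L[ℂ] PathHilbert V) :=
  NonUnitalAlgebra.adjoin ℂ (generators V)

/-- The tensor algebra `𝒜_G`: the norm closure of the algebra generated by the `L_e`, `L_x`. -/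
def tensorAlgebra : NonUnitalSubalgebra ℂ (PathHilbert V →L[ℂ] PathHilbert V) :=
  (algebraicPart V).topologicalClosure

/-- The left free semigroupoid algebra `𝔏_G`: the closure in the weak operator topology of the
algebra generated by the `L_e`, `L_x`. As a subspace of the bounded operators it carries the
operator norm. -/
def leftFreeSemigroupoidAlgebra :
    NonUnitalSubalgebra ℂ (PathHilbert V →L[ℂ] PathHilbert V) :=
  (((algebraicPart V).map (ContinuousLinearMapWOT.algEquiv (S := ℂ)).symm).topologicalClosure).comap
    (ContinuousLinearMapWOT.algEquiv (S := ℂ)).symm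

theorem mem_leftFreeSemigroupoidAlgebra_iff (T : PathHilbert V →L[ℂ] PathHilbert V) :
    T ∈ leftFreeSemigroupoidAlgebra V ↔
      ContinuousLinearMapWOT.ofCLM T ∈
        closure (ContinuousLinearMapWOT.ofCLM '' (algebraicPart V : Set _)) := Iff.rfl

theorem tensorAlgebra_le : tensorAlgebra V ≤ leftFreeSemigroupoidAlgebra V := by
  intro T hT
  rw [mem_leftFreeSemigroupoidAlgebra_iff]
  exact image_closure_subset_closure_image ContinuousLinearMapWOT.continuous_ofCLM
    ⟨T, hT, rfl⟩

variable {V}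

/-- A (bounded linear) map `δ : 𝒜_G → 𝔏_G` is a derivation if `δ(AB) = δ(A)B + Aδ(B)`. -/
def IsDerivation (δ : tensorAlgebra V →L[ℂ] leftFreeSemigroupoidAlgebra V) : Prop :=
  ∀ A B : tensorAlgebra V,
    (δ (A * B) : PathHilbert V →L[ℂ] PathHilbert V) =
      (δ A : PathHilbert V →L[ℂ] PathHilbert V) * (B : PathHilbert V →L[ℂ] PathHilbert V) +
        (A : PathHilbert V →L[ℂ] PathHilbert V) * (δ B : PathHilbert V →L[ℂ] PathHilbert V)

/-- `δ : 𝒜_G → 𝔏_G` is inner if there is `T ∈ 𝔏_G` with `δ(A) = AT - TA` for all `A ∈ 𝒜_G`. -/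
def IsInner (δ : tensorAlgebra V →L[ℂ] leftFreeSemigroupoidAlgebra V) : Prop :=
  ∃ T : leftFreeSemigroupoidAlgebra V, ∀ A : tensorAlgebra V,
    (δ A : PathHilbert V →L[ℂ] PathHilbert V) =
      (A : PathHilbert V →L[ℂ] PathHilbert V) * (T : PathHilbert V →L[ℂ] PathHilbert V) -
        (T : PathHilbert V →L[ℂ] PathHilbert V) * (A : PathHilbert V →L[ℂ] PathHilbert V)

end Operators

end FreeSemigroupoid

/-! Operators in `𝔏_G` commute with all right multiplications, so each is determined by its values
on the vertex vectors. With `T0 = ∑ δ(p_x) p_x` over the finitely many vertex projections `p_x`,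
adding the commutator `A T0 - T0 A` makes `δ` vanish on every `p_x`. What remains is recorded by
numbers `c w u` for parallel paths `w`, `u`: the coefficient of `u` in the value at `L_w`. The
Leibniz rule is a cocycle identity for concatenation, and boundedness of `δ` bounds the vectors `c
w` in `ℓ²` uniformly in `w`.

Uniform boundedness forces vanishing in two ways. If `Z` and `Z'` are incomparable at both ends,
exchanging one factor in a long power yields many distinct coefficients, all equal to `c Z Z'`
(`eq_zero_of_incomparable`). If two loops commute, the exchanges pile up in a single coefficient
(`eq_zero_of_commute`).

An implementing operator needs coefficients `τ_x(g)` on loops `g` that express `c e u` as a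
difference of terms from `u = e g` and `u = g e`. If some vertex emits two edges, there are paths
without short periods. Flanking two distinct short paths by such paths `P` and `Q` makes them
incomparable at both ends (`insertion`); expanding the resulting zero gives `c e u` in boundary
terms `c P (P g)` that depend on `g` alone, and these are `τ`. If no vertex emits two edges, all
loops at a vertex commute, and shortest paths to a fixed vertex provide `τ`.

So far `τ` is formal. It comes from a bounded operator because, for a suitable path `v` starting at
`x`, the operator `-L_v^* D(v)`, with `D` the corrected derivation, has the prescribed entries
between short paths ending at `x`. Its norm is bounded independently of `v`, and compactness
produces `T` (`exists_operator_of_matrix`). This `T` commutes with right multiplications, hence lies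
in `𝔏_G` by Fejér means (`mem_of_rightInvariant`); continuity passes from the generators to `𝒜_G`.
-/

namespace FreeSemigroupoid

/-! ### Combinatorics of paths: bounded cocycles, incomparability, periods. -/

section PathCombinatorics

open Quiver

variable {V : Type*} [Quiver V]

/-- Levi's lemma for paths: of two initial segments of a path the shorter one is an initial segment
of the longer one. -/
theorem levi {a b b' d : V} (p : Path a b) (q : Path a b') (p' : Path b d) (q' : Path b' d)
    (h : p.comp p' = q.comp q') (hl : p.length ≤ q.length) :
    ∃ g : Path b b', q = p.comp g ∧ p' = g.comp q' := by
  induction q' with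
  | nil => exact ⟨p', h.symm, rfl⟩
  | cons q'' e ih =>
    cases p' with
    | nil =>
      have := congrArg Path.length h
      simp at this
      omega
    | cons p'' e' =>
      rw [Path.comp_cons, Path.comp_cons] at h
      obtain rfl := Path.obj_eq_of_cons_eq_cons h
      obtain rfl := eq_of_heq (Path.hom_heq_of_cons_eq_cons h)
      obtain ⟨g, hg, rfl⟩ := ih p'' (eq_of_heq (Path.heq_of_cons_eq_cons h))
      exact ⟨g, hg, rfl⟩

theorem exists_shortest_path (hG : IsStronglyConnected V) (x y : V) :
    ∃ p : Path x y, ∀ q : Path x y, p.length ≤ q.length := by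
  obtain ⟨p0⟩ := hG x y
  obtain ⟨p, -, hp⟩ := (measure (Path.length (a := x) (b := y))).wf.has_min Set.univ ⟨p0, trivial⟩
  exact ⟨p, fun q => not_lt.1 fun h => hp q trivial h⟩

/-- The powers of a loop. -/
def loopPow {x : V} (l : Path x x) : ℕ → Path x x
  | 0 => Path.nil
  | n + 1 => (loopPow l n).comp l

theorem loopPow_add {x : V} (l : Path x x) (m n : ℕ) :
    loopPow l (m + n) = (loopPow l m).comp (loopPow l n) := by
  induction n with
  | zero => rfl
  | succ n ih => rw [← add_assoc, loopPow, ih, Path.comp_assoc, loopPow]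

theorem loopPow_one {x : V} (l : Path x x) : loopPow l 1 = l := Path.nil_comp l

theorem le_length_loopPow {x : V} (l : Path x x) (hl : 0 < l.length) (n : ℕ) :
    n ≤ (loopPow l n).length := by
  induction n with
  | zero => simp
  | succ n ih => rw [loopPow, Path.length_comp]; omega

/-- The values of a derivation on paths: `c w u` is the coefficient of `u` in the value at `w`. -/
def IsPathCocycle (c : ∀ ⦃x y : V⦄, Path x y → Path x y → ℂ) : Prop :=
  ∀ ⦃x y z : V⦄ (w : Path x y) (v : Path y z), c (w.comp v) =
    Function.extend (fun u : Path y z => w.comp u) (c v) 0 +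
      Function.extend (fun u : Path x y => u.comp v) (c w) 0

variable {c : ∀ ⦃x y : V⦄, Path x y → Path x y → ℂ}

theorem extend_comp_left {x y z : V} (w : Path x y) (f : Path y z → ℂ) (u : Path y z) :
    Function.extend (fun u : Path y z => w.comp u) f 0 (w.comp u) = f u :=
  (Path.comp_injective_right w).extend_apply f 0 u

theorem extend_comp_right {x y z : V} (v : Path y z) (f : Path x y → ℂ) (u : Path x y) :
    Function.extend (fun u : Path x y => u.comp v) f 0 (u.comp v) = f u :=
  (Path.comp_injective_left v).extend_apply f 0 u

theorem extend_eq_zero {α β : Type*} (k : α → β) (f : α → ℂ) (b : β) (h : ∀ a, k a ≠ b) :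
    Function.extend k f 0 b = 0 :=
  Function.extend_apply' _ _ _ fun ⟨a, ha⟩ => h a ha

namespace IsPathCocycle

variable (hc : IsPathCocycle c)
include hc

theorem apply_self_comp {x y z : V} (w : Path x y) (v : Path y z) :
    c (w.comp v) (w.comp v) = c v v + c w w := by
  rw [hc, Pi.add_apply, extend_comp_left, extend_comp_right]

/-- Of the three contributions in the expansion, that of `R` would need `Z` and `Z'` to have a
common continuation, that of `L` a common final overlap. Only the middle one survives. -/
theorem context {a x y b : V} (Z Z' : Path x y)
    (hs : ∀ {d : V} (R R' : Path y d), Z.comp R ≠ Z'.comp R')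
    (hr : ∀ {d : V} (L L' : Path d x), L.comp Z ≠ L'.comp Z') (L : Path a x) (R : Path y b) :
    c (L.comp (Z.comp R)) (L.comp (Z'.comp R)) = c Z Z' := by
  rw [hc, Pi.add_apply, extend_comp_left, extend_eq_zero, add_zero, hc, Pi.add_apply,
    extend_comp_right, extend_eq_zero, zero_add]
  · exact fun u => hs u R
  · intro u h
    rw [← Path.comp_assoc, ← Path.comp_assoc, Path.comp_inj_left] at h
    exact hr _ _ h

variable {M : ℝ} (hM : ∀ ⦃x y : V⦄ (w : Path x y) (S : Finset (Path x y)), ∑ u ∈ S, ‖c w u‖ ^ 2 ≤ M)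
include hM

/-- A bounded cocycle vanishes on pairs of parallel paths that are incomparable at both ends. -/
theorem eq_zero_of_incomparable (hG : IsStronglyConnected V) {x y : V} (Z Z' : Path x y)
    (hs : ∀ {d : V} (R R' : Path y d), Z.comp R ≠ Z'.comp R')
    (hr : ∀ {d : V} (L L' : Path d x), L.comp Z ≠ L'.comp Z') : c Z Z' = 0 := by
  classical
  obtain ⟨k⟩ := hG y x
  set Y := Z.comp k with hY
  set Y' := Z'.comp k with hY'
  have hs' : ∀ {d : V} (R R' : Path x d), Y.comp R ≠ Y'.comp R' := fun R R' => by
    rw [hY, hY', Path.comp_assoc, Path.comp_assoc]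
    exact hs _ _
  -- The `i`-th factor of `Y ^ N` is replaced by `Y'`. These `N` paths are distinct and all carry
  -- the coefficient `c Z Z'`.
  let u (N i : ℕ) : Path x x := (loopPow Y i).comp (Y'.comp (loopPow Y (N - 1 - i)))
  have hu (N i : ℕ) (hi : i < N) : c (loopPow Y N) (u N i) = c Z Z' := by
    have h1 : loopPow Y N = (loopPow Y i).comp (Z.comp (k.comp (loopPow Y (N - 1 - i)))) := by
      rw [← Path.comp_assoc Z, ← hY, ← loopPow_one Y, loopPow_one Y]
      nth_rewrite 3 [← loopPow_one Y]
      rw [← loopPow_add, ← loopPow_add]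
      congr 1
      omega
    have h2 : u N i = (loopPow Y i).comp (Z'.comp (k.comp (loopPow Y (N - 1 - i)))) := by
      simp only [u, hY', Path.comp_assoc]
    rw [h1, h2]
    exact hc.context Z Z' hs hr _ _
  have key (N i j : ℕ) (hij : i < j) : u N i ≠ u N j := by
    intro h
    have hj : loopPow Y j = (loopPow Y i).comp (Y.comp (loopPow Y (j - i - 1))) := by
      nth_rewrite 3 [← loopPow_one Y]
      rw [← loopPow_add, ← loopPow_add]
      congr 1
      omega
    change (loopPow Y i).comp (Y'.comp _) = (loopPow Y j).comp (Y'.comp _) at h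
    rw [hj, Path.comp_assoc (loopPow Y i), Path.comp_inj_right, Path.comp_assoc Y] at h
    exact hs' _ _ h.symm
  have hinj (N : ℕ) : Function.Injective (u N) := by
    intro i j h
    rcases lt_trichotomy i j with hij | hij | hij
    · exact absurd h (key N i j hij)
    · exact hij
    · exact absurd h.symm (key N j i hij)
  have bound (N : ℕ) : (N : ℝ) * ‖c Z Z'‖ ^ 2 ≤ M := by
    have h := hM (loopPow Y N) ((Finset.range N).image (u N))
    rw [Finset.sum_image ((hinj N).injOn),
      Finset.sum_congr rfl fun i hi => by rw [hu N i (Finset.mem_range.1 hi)]] at h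
    simpa using h
  by_contra hne
  have hpos : 0 < ‖c Z Z'‖ ^ 2 := by positivity
  obtain ⟨N, hN⟩ := exists_nat_gt (M / ‖c Z Z'‖ ^ 2)
  rw [div_lt_iff₀ hpos] at hN
  exact absurd (bound N) (not_le.2 hN)

/-- A bounded cocycle vanishes on pairs of commuting loops. -/
theorem eq_zero_of_commute {x : V} (l l' : Path x x) (h : l.comp l' = l'.comp l) : c l l' = 0 := by
  -- By commutation, exchanging any of the `n + 1` factors `l` for `l'` gives the same path, so the
  -- contributions add up.
  have key (n : ℕ) : c (loopPow l (n + 1)) ((loopPow l n).comp l') = (n + 1) * c l l' := by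
    induction n with
    | zero => simp [loopPow]
    | succ n ih =>
      have h2 : (loopPow l (n + 1)).comp l' = ((loopPow l n).comp l').comp l := by
        rw [loopPow, Path.comp_assoc, h, Path.comp_assoc]
      have h3 : c (loopPow l (n + 1 + 1)) ((loopPow l (n + 1)).comp l') =
          c l l' + c (loopPow l (n + 1)) ((loopPow l n).comp l') := by
        rw [loopPow, hc, Pi.add_apply, extend_comp_left]
        rw [h2, extend_comp_right]
      rw [h3, ih]
      push_cast
      ring
  by_contra hne
  have hpos : 0 < ‖c l l'‖ ^ 2 := by positivity
  obtain ⟨N, hN⟩ := exists_nat_gt (M / ‖c l l'‖ ^ 2)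
  rw [div_lt_iff₀ hpos] at hN
  have h1 := hM (loopPow l (N + 1)) {(loopPow l N).comp l'}
  rw [Finset.sum_singleton, key, norm_mul, mul_pow] at h1
  have h2 : ‖((N : ℂ) + 1)‖ = N + 1 := by
    rw [← Nat.cast_succ, Complex.norm_natCast, Nat.cast_succ]
  rw [h2] at h1
  refine absurd (hN.trans_le ?_) (not_lt.2 h1)
  have : (N : ℝ) ≤ (N + 1) ^ 2 := by nlinarith [(Nat.cast_nonneg N : (0 : ℝ) ≤ N)]
  exact mul_le_mul_of_nonneg_right this hpos.le

end IsPathCocycle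

/-- A path without periods of length between `1` and `n`. -/
def Aperiodic (n : ℕ) {x y : V} (p : Path x y) : Prop :=
  ∀ (Y : Path x x) (X : Path y y), p.comp X = Y.comp p → Y.length ≤ n → Y.length = 0

namespace Aperiodic

variable {n : ℕ} {x y : V} {p : Path x y}

theorem mono (hp : Aperiodic n p) {m : ℕ} (h : m ≤ n) : Aperiodic m p :=
  fun Y X hYX hl => hp Y X hYX (hl.trans h)

theorem comp_left (hp : Aperiodic n p) {a : V} (q : Path a x) : Aperiodic n (q.comp p) := by
  intro Y X h hl
  rw [Path.comp_assoc, ← Path.comp_assoc Y] at h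
  obtain ⟨g, hg, hg'⟩ := levi _ _ _ _ h (by rw [Path.length_comp]; omega)
  have := congrArg Path.length hg
  rw [Path.length_comp, Path.length_comp] at this
  have := hp g X hg' (by omega)
  omega

theorem comp_right (hp : Aperiodic n p) {b : V} (q : Path y b) : Aperiodic n (p.comp q) := by
  intro Y X h hl
  rw [Path.comp_assoc, ← Path.comp_assoc Y] at h
  obtain ⟨g, hg, -⟩ := levi _ _ _ _ h (by rw [Path.length_comp]; omega)
  exact hp Y g hg.symm hl

/-- If the paths agreed, the longer of `E`, `U` would be the shorter one followed by some `g`, and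
`g` would be a period of `p` of length at most `n`. -/
theorem comp_comp_ne (hp : Aperiodic n p) {s t : V} {E U : Path s x} (hne : E ≠ U)
    (hE : E.length ≤ n) (hU : U.length ≤ n) (R R' : Path y t) :
    (E.comp p).comp R ≠ (U.comp p).comp R' := by
  have key : ∀ {E U : Path s x} (R R' : Path y t), E ≠ U → U.length ≤ n → E.length ≤ U.length →
      (E.comp p).comp R ≠ (U.comp p).comp R' := by
    intro E U R R' hne hU hl h
    rw [Path.comp_assoc, Path.comp_assoc] at h
    obtain ⟨g, rfl, hg⟩ := levi _ _ _ _ h hl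
    rw [← Path.comp_assoc] at hg
    obtain ⟨X, hX, -⟩ := levi _ _ _ _ hg (by rw [Path.length_comp]; omega)
    rw [Path.length_comp] at hU
    have := hp g X hX.symm (by omega)
    obtain rfl := Path.eq_nil_of_length_zero g this
    exact hne rfl
  rcases le_total E.length U.length with hl | hl
  · exact key R R' hne hU hl
  · exact (key R' R hne.symm hE hl).symm

/-- The overhang `g` now sits to the right of `p`, but `p g = k p` with `k` of the same length, so
it is again a period. -/
theorem comp_comp_ne' (hp : Aperiodic n p) {s t : V} {E U : Path y t} (hne : E ≠ U)
    (hE : E.length ≤ n) (hU : U.length ≤ n) (L L' : Path s x) :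
    L.comp (p.comp E) ≠ L'.comp (p.comp U) := by
  have key : ∀ {E U : Path y t} (L L' : Path s x), E ≠ U → U.length ≤ n → E.length ≤ U.length →
      L.comp (p.comp E) ≠ L'.comp (p.comp U) := by
    intro E U L L' hne hU hl h
    have hlen := congrArg Path.length h
    simp only [Path.length_comp] at hlen
    have h' : L'.comp (p.comp U) = (L.comp p).comp E := by rw [← h, Path.comp_assoc]
    rw [← Path.comp_assoc] at h'
    obtain ⟨g, hg, rfl⟩ := levi _ _ _ _ h' (by simp only [Path.length_comp]; omega)
    rw [Path.comp_assoc] at hg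
    obtain ⟨k, rfl, hk⟩ := levi _ _ _ _ hg.symm (by omega)
    have h1 := congrArg Path.length hk
    simp only [Path.length_comp] at h1 hU
    have := hp k g hk (by omega)
    obtain rfl := Path.eq_nil_of_length_zero g (by omega)
    exact hne (Path.nil_comp E).symm
  rcases le_total E.length U.length with hl | hl
  · exact key L L' hne hU hl
  · exact (key L' L hne.symm hE hl).symm

end Aperiodic

/-- The path `p` does not run through the edge `f`. -/
def Avoids {z a : V} (f : z ⟶ a) {x y : V} (p : Path x y) : Prop :=
  ∀ (S : Path x z) (X : Path a y), p ≠ (S.cons f).comp X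

namespace Avoids

variable {z a : V} {f : z ⟶ a}

theorem nil (x : V) : Avoids f (Path.nil : Path x x) := by
  intro S X h
  have := congrArg Path.length h
  simp at this
  omega

theorem comp {x y w : V} {p : Path x y} {q : Path y w} (hp : Avoids f p) (hq : Avoids f q) :
    Avoids f (p.comp q) := by
  intro S X h
  rcases le_or_gt (S.cons f).length p.length with hl | hl
  · obtain ⟨g, hg, -⟩ := levi _ _ _ _ h.symm hl
    exact hp S g hg
  · obtain ⟨g, hg, hg'⟩ := levi _ _ _ _ h hl.le
    cases g with
    | nil =>
      rw [Path.comp_nil] at hg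
      rw [hg] at hl
      exact lt_irrefl _ hl
    | cons g' e =>
      rw [Path.comp_cons] at hg
      obtain rfl := Path.obj_eq_of_cons_eq_cons hg
      obtain rfl := eq_of_heq (Path.hom_heq_of_cons_eq_cons hg)
      exact hq g' X hg'

theorem loopPow {x : V} {l : Path x x} (hl : Avoids f l) (n : ℕ) : Avoids f (loopPow l n) := by
  induction n with
  | zero => exact Avoids.nil x
  | succ n ih => exact ih.comp hl

theorem toPath {b : V} {e : z ⟶ b} (h : (⟨b, e⟩ : Σ b, z ⟶ b) ≠ ⟨a, f⟩) : Avoids f e.toPath := by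
  intro S X hX
  cases X with
  | nil =>
    have h1 := eq_of_heq (Path.hom_heq_of_cons_eq_cons hX)
    exact h (by rw [h1])
  | cons X' e' =>
    have := congrArg Path.length hX
    simp at this

/-- Traversing an edge out of `z` would mean an earlier visit to `z`, hence a shorter path. -/
theorem of_shortest {b : V} {r : Path b z} (hr : ∀ q : Path b z, r.length ≤ q.length) : Avoids f r := by
  intro S X h
  have h1 := hr S
  have h2 := congrArg Path.length h
  simp at h2
  omega

/-- The edge `f` occurs only at the end; a nontrivial period of length at most that of `p` would
move this occurrence into `p`. -/
theorem aperiodic_cons {x : V} {p : Path x z} (hp : Avoids f p) :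
    Aperiodic p.length (p.cons f) := by
  intro Y X h hl
  cases X with
  | nil =>
    have := congrArg Path.length h
    simp only [Path.comp_nil, Path.length_comp, Path.length_cons] at this
    omega
  | cons X' e =>
    rw [Path.comp_cons, Path.comp_cons] at h
    obtain rfl := Path.obj_eq_of_cons_eq_cons h
    obtain rfl := eq_of_heq (Path.hom_heq_of_cons_eq_cons h)
    have h := eq_of_heq (Path.heq_of_cons_eq_cons h)
    by_contra hY
    obtain ⟨g, hg, hg'⟩ := levi _ _ _ _ h.symm (by simpa using Nat.le_succ_of_le hl)
    have hlen := congrArg Path.length h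
    simp at hlen
    have hlg := congrArg Path.length hg'
    simp at hlg
    cases g with
    | nil =>
      simp at hlg
      omega
    | cons g' e' =>
      rw [Path.comp_cons] at hg
      obtain rfl := Path.obj_eq_of_cons_eq_cons hg
      obtain rfl := eq_of_heq (Path.hom_heq_of_cons_eq_cons hg)
      exact hp g' X' hg'

end Avoids

end PathCombinatorics

end FreeSemigroupoid

namespace FreeSemigroupoid

/-! ### Potentials built from aperiodic paths. -/

section Potential

open Quiver

variable {V : Type*} [Quiver V]

/-- A function `τ` on the loops that implements the cocycle `c` on edges, and whose finite pieces
are obtained from the values of `c` at single paths. -/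
structure IsPotential (c : ∀ ⦃x y : V⦄, Path x y → Path x y → ℂ) (τ : ∀ x : V, Path x x → ℂ) :
    Prop where
  edge : ∀ ⦃x y : V⦄ (e : x ⟶ y) (u : Path x y), c e.toPath u =
    Function.extend (fun g : Path y y => e.toPath.comp g) (τ y) 0 u -
      Function.extend (fun g : Path x x => g.comp e.toPath) (τ x) 0 u
  approx : ∀ (x : V) (n : ℕ), ∃ (y : V) (v : Path x y), ∀ ⦃s : V⦄ (u w : Path s x),
    u.length ≤ n → w.length ≤ n →
      -Function.extend (fun g : Path x y => w.comp g) (c v) 0 (u.comp v) =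
        Function.extend (fun g : Path x x => w.comp g) (τ x) 0 u

variable {c : ∀ ⦃x y : V⦄, Path x y → Path x y → ℂ}

namespace IsPathCocycle

variable (hc : IsPathCocycle c) {M : ℝ}
  (hM : ∀ ⦃x y : V⦄ (w : Path x y) (S : Finset (Path x y)), ∑ u ∈ S, ‖c w u‖ ^ 2 ≤ M)
include hc hM

/-- Read from the left, after cancelling `P`, the aperiodic `Q` separates `E` from `U`; read from
the right, after cancelling `Q`, the aperiodic `P` does. -/
theorem insertion (hG : IsStronglyConnected V) {n : ℕ} {a x y b : V} {P : Path a x} {Q : Path y b}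
    (hP : Aperiodic n P) (hQ : Aperiodic n Q) {E U : Path x y} (hne : E ≠ U)
    (hE : E.length ≤ n) (hU : U.length ≤ n) : c (P.comp (E.comp Q)) (P.comp (U.comp Q)) = 0 := by
  refine hc.eq_zero_of_incomparable hM hG _ _ (fun R R' => ?_) (fun L L' => ?_)
  · rw [Path.comp_assoc P, Path.comp_assoc P, Ne, Path.comp_inj_right]
    exact fun h => hQ.comp_comp_ne hne hE hU R R' h
  · rw [← Path.comp_assoc P, ← Path.comp_assoc P, ← Path.comp_assoc L, ← Path.comp_assoc L', Ne,
      Path.comp_inj_left]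
    exact fun h => hP.comp_comp_ne' hne hE hU L L' h

/-- Inserting `g` between `P` and `Q` leaves two boundary terms. Fixing `Q` shows that `c P (P.comp
g)` does not depend on `P`, so a potential can be defined by it. -/
theorem add_eq_zero_of_aperiodic (hG : IsStronglyConnected V) {a x b : V} {P : Path a x}
    {Q : Path x b} {g : Path x x} (hg : g ≠ Path.nil) (hP : Aperiodic g.length P)
    (hQ : Aperiodic g.length Q) : c Q (g.comp Q) + c P (P.comp g) = 0 := by
  have h := hc.insertion hM hG hP hQ hg.symm (Nat.zero_le _) le_rfl
  rw [Path.nil_comp, hc, Pi.add_apply, extend_comp_left, ← Path.comp_assoc, extend_comp_right] at h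
  exact h

/-- Here `g` is deleted between `P` and `Q`; as `Q` does not begin with `g`, only the term at `P`
survives. -/
theorem comp_loop_apply_eq_zero (hG : IsStronglyConnected V) {a x b : V} {P : Path a x}
    {g : Path x x} (hg : g ≠ Path.nil) (hP : Aperiodic g.length P) {Q : Path x b}
    (hQ : Aperiodic g.length Q) (hQg : ∀ p, Q ≠ g.comp p) : c (P.comp g) P = 0 := by
  have h := hc.insertion hM hG hP hQ hg le_rfl (Nat.zero_le _)
  rw [Path.nil_comp, ← Path.comp_assoc, hc, Pi.add_apply, extend_comp_right, extend_eq_zero,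
    zero_add] at h
  · exact h
  · intro u hu
    rw [Path.comp_assoc, Path.comp_inj_right] at hu
    exact hQg u hu.symm

/-- Deleting one `g` from `P g g p` gives this term plus `c (P.comp g) P`, which vanishes by
`comp_loop_apply_eq_zero`. -/
theorem loop_comp_apply_eq_zero (hG : IsStronglyConnected V) {a x b d : V} {P : Path a x}
    {g : Path x x} (hg : g ≠ Path.nil) (hP : Aperiodic g.length P) {Q : Path x b}
    (hQ : Aperiodic g.length Q) (hQg : ∀ p, Q ≠ g.comp p) {p : Path x d}
    (hp : Aperiodic g.length p) : c (g.comp p) p = 0 := by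
  have h := hc.insertion hM hG (hP.comp_right g) hp hg le_rfl (Nat.zero_le _)
  rw [Path.nil_comp, hc, Pi.add_apply, extend_comp_left] at h
  have h1 : (P.comp g).comp p = P.comp (g.comp p) := Path.comp_assoc _ _ _
  rw [h1, extend_comp_right, hc.comp_loop_apply_eq_zero hM hG hg hP hQ hQg, add_zero] at h
  exact h

/-- The expansion of `c (P e Q) (P u Q) = 0` expresses `c e u` by boundary terms. The hypotheses on
trimmed paths and on avoiding `g` remove the terms in which a path gets shorter. The common endpoint
`y0` normalizes the coefficients at trivial loops. -/
theorem exists_potential_of_aperiodic (hG : IsStronglyConnected V) (y0 : V)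
    (hQ : ∀ (n : ℕ) (x : V), ∃ Q : Path x y0, Aperiodic n Q ∧
      ∀ (y : V) (g : Path x y) (p : Path y y0), Q = g.comp p → g.length ≤ n → Aperiodic n p)
    (hP : ∀ (n : ℕ) (x : V), ∃ (a : V) (P : Path a x), Aperiodic n P ∧
      ∀ (y : V) (p : Path a y) (g : Path y x), P = p.comp g → g.length ≤ n → Aperiodic n p)
    (hN : ∀ (n : ℕ) (x : V) (g : Path x x), g ≠ Path.nil → ∃ (b : V) (Q : Path x b),
      Aperiodic n Q ∧ ∀ p, Q ≠ g.comp p) :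
    ∃ τ, IsPotential c τ := by
  classical
  choose a P hP1 hP2 using hP
  have k (x : V) : Path x y0 := (hG x y0).some
  let τ (x : V) (g : Path x x) : ℂ :=
    if g = Path.nil then -c (k x) (k x) else c (P g.length x) ((P g.length x).comp g)
  -- A path `r` back to `x` turns `v` into a loop at `y0`. A loop commutes with itself, so its
  -- diagonal coefficient is zero and `c v v = -c r r` for every `v`.
  have τnil (x : V) (v : Path x y0) : c v v = -τ x Path.nil := by
    simp only [τ, if_true, neg_neg]
    obtain ⟨r⟩ := hG y0 x
    have h (v : Path x y0) : c r r + c v v = 0 := by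
      rw [← hc.apply_self_comp]
      exact hc.eq_zero_of_commute hM _ _ rfl
    exact add_left_cancel ((h v).trans (h (k x)).symm)
  have τQ {x b : V} (g : Path x x) (hg : g ≠ Path.nil) (Q : Path x b)
      (hQ : Aperiodic g.length Q) : c Q (g.comp Q) = -τ x g := by
    simp only [τ, if_neg hg]
    exact eq_neg_of_add_eq_zero_left (hc.add_eq_zero_of_aperiodic hM hG hg (hP1 _ _) hQ)
  have τP {x b : V} (g : Path x x) (hg : g ≠ Path.nil) (R : Path b x)
      (hR : Aperiodic g.length R) : c R (R.comp g) = τ x g := by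
    obtain ⟨Q, hQ1, -⟩ := hQ g.length x
    have h := hc.add_eq_zero_of_aperiodic hM hG hg hR hQ1
    rw [τQ g hg Q hQ1] at h
    exact (eq_of_neg_add_eq_zero h).symm
  have negP {x b : V} (g : Path x x) (hg : g ≠ Path.nil) (R : Path b x)
      (hR : Aperiodic g.length R) : c (R.comp g) R = 0 := by
    obtain ⟨b, Q, hQ1, hQ2⟩ := hN g.length x g hg
    exact hc.comp_loop_apply_eq_zero hM hG hg hR hQ1 hQ2
  have negQ {x b : V} (g : Path x x) (hg : g ≠ Path.nil) (p : Path x b)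
      (hp : Aperiodic g.length p) : c (g.comp p) p = 0 := by
    obtain ⟨b, Q, hQ1, hQ2⟩ := hN g.length x g hg
    exact hc.loop_comp_apply_eq_zero hM hG hg (hP1 _ _) hQ1 hQ2 hp
  have len_pos {x : V} {g : Path x x} (h : g.length = 0) : g = Path.nil :=
    Path.eq_nil_of_length_zero g h
  refine ⟨τ, fun x y e u => ?_, fun x n => ?_⟩
  · by_cases hu : u = e.toPath
    · subst hu
      have h1 := extend_comp_left e.toPath (τ y) Path.nil
      have h2 := extend_comp_right e.toPath (τ x) Path.nil
      rw [Path.comp_nil] at h1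
      rw [Path.nil_comp] at h2
      rw [h1, h2]
      have h3 := hc.apply_self_comp e.toPath (k y)
      rw [τnil, τnil] at h3
      linear_combination -h3
    -- This `n` dominates both the length of `u` and the length 1 of the edge, also when `u` is
    -- trivial.
    · set n := u.length + 1 with hn
      obtain ⟨Q, hQ1, hQ2⟩ := hQ n y
      have h := hc.insertion hM hG (hP1 n x) hQ1 (Ne.symm hu) (by simp [hn]) (by omega)
      rw [hc, Pi.add_apply, extend_comp_left, hc, Pi.add_apply, extend_comp_right] at h
      have hA : Function.extend (fun g : Path y y0 => e.toPath.comp g) (c Q) 0 (u.comp Q) =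
          -Function.extend (fun g : Path y y => e.toPath.comp g) (τ y) 0 u := by
        by_cases hg : ∃ g, e.toPath.comp g = u
        · obtain ⟨g, rfl⟩ := hg
          rw [Path.comp_assoc, extend_comp_left, extend_comp_left]
          refine τQ g ?_ Q (hQ1.mono ?_)
          · rintro rfl
            exact hu rfl
          · rw [hn, Path.length_comp]
            omega
        · rw [extend_eq_zero (b := u) _ _ fun g hg' => hg ⟨g, hg'⟩, neg_zero]
          -- If `u` does not begin with `e`, an overlap forces `u` to be trivial and `Q = e q`; the
          -- term is then `c (e q) q`, killed by `negQ`.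
          by_cases hq : ∃ q, e.toPath.comp q = u.comp Q
          · obtain ⟨q, hq⟩ := hq
            rcases Nat.eq_zero_or_pos u.length with h0 | h0
            · obtain rfl := Path.eq_of_length_zero u h0
              obtain rfl := len_pos h0
              rw [Path.nil_comp] at hq ⊢
              rw [← hq, extend_comp_left]
              exact negQ e.toPath (Path.cons_ne_nil _ _) q
                (hQ2 _ e.toPath q hq.symm (by simp [hn]))
            · obtain ⟨g, hg', -⟩ := levi _ _ _ _ hq h0
              exact absurd ⟨g, hg'.symm⟩ hg
          · exact extend_eq_zero _ _ _ fun q hq' => hq ⟨q, hq'⟩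
      have hB : Function.extend (fun g : Path (a n x) x => g.comp (e.toPath.comp Q)) (c (P n x)) 0
            ((P n x).comp (u.comp Q)) =
          Function.extend (fun g : Path x x => g.comp e.toPath) (τ x) 0 u := by
        by_cases hg : ∃ g : Path x x, g.comp e.toPath = u
        · obtain ⟨g, rfl⟩ := hg
          rw [extend_comp_right, Path.comp_assoc, ← Path.comp_assoc, extend_comp_right]
          refine τP g ?_ _ ((hP1 n x).mono ?_)
          · rintro rfl
            exact hu (Path.nil_comp _)
          · rw [hn, Path.length_comp]
            omega
        · rw [extend_eq_zero (b := u) _ _ fun g hg' => hg ⟨g, hg'⟩]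
          by_cases hq : ∃ q : Path (a n x) x, q.comp (e.toPath.comp Q) = (P n x).comp (u.comp Q)
          · obtain ⟨q, hq⟩ := hq
            have hq' := hq
            rw [← Path.comp_assoc, ← Path.comp_assoc, Path.comp_inj_left] at hq'
            have hlen := congrArg Path.length hq'
            simp only [Path.length_comp, Path.length_toPath] at hlen
            rcases Nat.eq_zero_or_pos u.length with h0 | h0
            · obtain rfl := Path.eq_of_length_zero u h0
              obtain rfl := len_pos h0
              rw [Path.comp_nil] at hq'
              rw [← hq, extend_comp_right, ← hq']
              exact negP e.toPath (Path.cons_ne_nil _ _) q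
                (hP2 n _ _ q e.toPath hq'.symm (by simp [hn]))
            · obtain ⟨g, -, hg'⟩ := levi _ _ _ _ hq'.symm (by omega)
              exact absurd ⟨g, hg'.symm⟩ hg
          · exact extend_eq_zero _ _ _ fun q hq' => hq ⟨q, hq'⟩
      rw [hA, hB] at h
      linear_combination h
  · obtain ⟨v, hv1, hv2⟩ := hQ n x
    refine ⟨y0, v, fun s u w hu hw => ?_⟩
    by_cases hg : ∃ g, w.comp g = u
    · obtain ⟨g, rfl⟩ := hg
      rw [Path.comp_assoc, extend_comp_left, extend_comp_left]
      by_cases hgn : g = Path.nil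
      · subst hgn
        rw [Path.nil_comp, τnil, neg_neg]
      · rw [τQ g hgn v (hv1.mono _), neg_neg]
        rw [Path.length_comp] at hu
        omega
    · rw [extend_eq_zero (b := u) _ _ fun g hg' => hg ⟨g, hg'⟩, neg_eq_zero]
      by_cases hq : ∃ q, w.comp q = u.comp v
      · obtain ⟨q, hq⟩ := hq
        rcases le_total w.length u.length with hl | hl
        · obtain ⟨g, hg', -⟩ := levi _ _ _ _ hq hl
          exact absurd ⟨g, hg'.symm⟩ hg
        -- Now `w = u g` and `v = g q`, so the coefficient is `c (g q) q`, again of the vanishing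
        -- kind.
        · obtain ⟨g, rfl, hgv⟩ := levi _ _ _ _ hq.symm hl
          rw [← hq, extend_comp_left, hgv]
          rw [Path.length_comp] at hw
          refine negQ g ?_ q ((hv2 _ g q hgv (by omega)).mono (by omega))
          rintro rfl
          exact hg ⟨Path.nil, rfl⟩
      · exact extend_eq_zero _ _ _ fun q hq' => hq ⟨q, hq'⟩

/-- A vertex emitting two edges gives rise to aperiodic paths. -/
theorem exists_potential_of_branching (hG : IsStronglyConnected V) {z a a' : V} (f : z ⟶ a)
    (f' : z ⟶ a') (hf : (⟨a, f⟩ : Σ b, z ⟶ b) ≠ ⟨a', f'⟩) : ∃ τ, IsPotential c τ := by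
  obtain ⟨r, hr⟩ := exists_shortest_path hG a z
  -- This loop leaves `z` by `f` and returns by a shortest path, so it never uses `f'`; in `l ^ n
  -- f'` the edge `f'` occurs only at the end.
  set l : Path z z := f.toPath.comp r with hl_def
  have hl : 0 < l.length := by simp [hl_def]
  have hlf : Avoids f' l := (Avoids.toPath hf).comp (Avoids.of_shortest hr)
  let B (n : ℕ) : Path z a' := (loopPow l n).cons f'
  have hB (n : ℕ) : Aperiodic n (B n) :=
    (hlf.loopPow n).aperiodic_cons.mono (le_length_loopPow l hl n)
  refine hc.exists_potential_of_aperiodic hM hG a' (fun n x => ?_) (fun n x => ?_) fun n x g hg => ?_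
  · obtain ⟨p⟩ := hG x z
    -- The additional power of `l` is a buffer of length at least `n`: trimming at most `n` edges
    -- leaves `B n` intact.
    refine ⟨(p.comp (loopPow l n)).comp (B n), (hB n).comp_left _, fun y g q hq hgn => ?_⟩
    have := le_length_loopPow l hl n
    obtain ⟨h, -, rfl⟩ := levi _ _ _ _ hq.symm (by rw [Path.length_comp]; omega)
    exact (hB n).comp_left h
  · obtain ⟨p⟩ := hG a' z
    obtain ⟨q⟩ := hG z x
    refine ⟨z, (B n).comp ((p.comp (loopPow l n)).comp q), (hB n).comp_right _,
      fun y p' g hq hgn => ?_⟩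
    have := le_length_loopPow l hl n
    have hlen := congrArg Path.length hq
    simp only [Path.length_comp] at hlen
    obtain ⟨h, rfl, -⟩ := levi _ _ _ _ hq (by omega)
    exact (hB n).comp_right h
  · obtain ⟨p, hp⟩ := exists_shortest_path hG x z
    obtain ⟨s⟩ := hG a z
    obtain ⟨s'⟩ := hG a' z
    -- Since `p` is shortest, no nontrivial loop is an initial segment of it. Hence `g` reaches
    -- beyond `p` and contains the edge taken there, so it cannot begin both the path through `f`
    -- and the one through `f'`.
    have key {b y : V} (e : z ⟶ b) (t : Path b y) (q : Path x y)
        (h : p.comp (e.toPath.comp t) = g.comp q) : ∃ h', g = p.comp (e.toPath.comp h') := by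
      rcases le_or_gt g.length p.length with hgl | hgl
      · obtain ⟨q', rfl, -⟩ := levi _ _ _ _ h.symm hgl
        have h1 := hp q'
        rw [Path.length_comp] at h1
        exact absurd (Path.eq_nil_of_length_zero g (by omega)) hg
      · rw [← Path.comp_assoc] at h
        obtain ⟨h', hh', -⟩ := levi _ _ _ _ h (by rw [Path.length_comp]; simpa using hgl)
        exact ⟨h', by rw [hh', Path.comp_assoc]⟩
    by_cases h1 : ∀ q, p.comp (f.toPath.comp (s.comp (B n))) ≠ g.comp q
    · exact ⟨_, _, ((hB n).comp_left s).comp_left _ |>.comp_left _, h1⟩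
    · refine ⟨_, p.comp (f'.toPath.comp (s'.comp (B n))),
        ((hB n).comp_left s').comp_left _ |>.comp_left _, fun q hq => ?_⟩
      push Not at h1
      obtain ⟨q1, hq1⟩ := h1
      obtain ⟨h1, hh1⟩ := key f _ q1 hq1
      obtain ⟨h2, hh2⟩ := key f' _ q hq
      rw [hh1, Path.comp_inj_right] at hh2
      obtain ⟨g', hg', -⟩ := levi _ _ _ _ hh2 le_rfl
      cases g' with
      | nil => exact hf (by rw [eq_of_heq (Path.hom_heq_of_cons_eq_cons hg')])
      | cons g'' e =>
        have := congrArg Path.length hg'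
        simp at this

end IsPathCocycle

end Potential

end FreeSemigroupoid

namespace FreeSemigroupoid

/-! ### Graphs without branching. -/

section CycleGraph

open Quiver

variable {V : Type*} [Quiver V]

theorem exists_edge_from {x y : V} (p : Path x y) (hp : 0 < p.length) : ∃ b, Nonempty (x ⟶ b) := by
  induction p with
  | nil => simp at hp
  | cons p e ih =>
    cases p with
    | nil => exact ⟨_, ⟨e⟩⟩
    | cons p' e' => exact ih (by simp)

/-- In a finite strongly connected graph whose vertices emit at most one edge each, every vertex
receives at most one edge. -/
theorem subsingleton_in_edges [Finite V] (hG : IsStronglyConnected V)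
    (hU : ∀ z : V, Subsingleton (Σ b, z ⟶ b)) (y : V) : Subsingleton (Σ b, b ⟶ y) := by
  refine ⟨fun ⟨x, e⟩ ⟨x', e'⟩ => ?_⟩
  have hout (a : V) : ∃ b, Nonempty (a ⟶ b) := by
    obtain ⟨p⟩ := hG a x
    exact exists_edge_from (p.cons e) (by simp)
  choose σ f using hout
  have hσ {a b : V} (g : a ⟶ b) : σ a = b :=
    congrArg Sigma.fst ((hU a).elim ⟨σ a, (f a).some⟩ ⟨b, g⟩)
  have hsurj : Function.Surjective σ := by
    intro b
    obtain ⟨p⟩ := hG y b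
    cases p with
    | nil => exact ⟨x, hσ e⟩
    | cons p g => exact ⟨_, hσ g⟩
  obtain rfl := Finite.injective_iff_surjective.2 hsurj ((hσ e).trans (hσ e').symm)
  have := (hU x).elim ⟨y, e⟩ ⟨y, e'⟩
  rw [eq_of_heq (Sigma.mk.inj this).2]

theorem path_unique (hU : ∀ z : V, Subsingleton (Σ b, z ⟶ b)) {x y y' : V} (p : Path x y)
    (q : Path x y') (h : p.length = q.length) : (⟨y, p⟩ : Σ y, Path x y) = ⟨y', q⟩ := by
  induction p generalizing y' with
  | nil =>
    cases q with
    | nil => rfl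
    | cons q e => simp at h
  | cons p e ih =>
    cases q with
    | nil => simp at h
    | cons q e' =>
      cases ih q (by simpa using h)
      cases (hU _).elim ⟨_, e⟩ ⟨_, e'⟩
      rfl

theorem exists_eq_comp (hU : ∀ z : V, Subsingleton (Σ b, z ⟶ b)) {x y y' : V} (p : Path x y)
    (q : Path x y') (h : p.length ≤ q.length) : ∃ g : Path y y', q = p.comp g := by
  induction q with
  | nil =>
    cases path_unique hU p Path.nil (by simpa using h)
    exact ⟨Path.nil, rfl⟩
  | cons q e ih =>
    rcases h.lt_or_eq with h | h
    · obtain ⟨g, rfl⟩ := ih (by simpa [Nat.lt_succ_iff] using h)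
      exact ⟨g.cons e, rfl⟩
    · cases path_unique hU p _ h
      exact ⟨Path.nil, rfl⟩

theorem exists_eq_comp' (hI : ∀ z : V, Subsingleton (Σ b, b ⟶ z)) {x x' y : V} (p : Path x y)
    (q : Path x' y) (h : p.length ≤ q.length) : ∃ g : Path x' x, q = g.comp p := by
  induction p with
  | nil => exact ⟨q, rfl⟩
  | cons p e ih =>
    cases q with
    | nil => simp at h
    | cons q e' =>
      cases (hI _).elim ⟨_, e⟩ ⟨_, e'⟩
      obtain ⟨g, rfl⟩ := ih q (by simpa using h)
      exact ⟨g, rfl⟩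

variable {c : ∀ ⦃x y : V⦄, Path x y → Path x y → ℂ}

namespace IsPathCocycle

variable (hc : IsPathCocycle c) {M : ℝ}
  (hM : ∀ ⦃x y : V⦄ (w : Path x y) (S : Finset (Path x y)), ∑ u ∈ S, ‖c w u‖ ^ 2 ≤ M)
include hc hM

/-- Paths are determined by source and length, so loops at a vertex commute and `c` vanishes on
them. With `v x` a shortest path to `x0`, one has `e (v y) = (v x) l` for a loop `l` at `x0`;
expanding `c` along both factorizations gives the edge identity. -/
theorem exists_potential_of_cycle [Finite V] (hG : IsStronglyConnected V)
    (hU : ∀ z : V, Subsingleton (Σ b, z ⟶ b)) (x0 : V) : ∃ τ, IsPotential c τ := by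
  have hI := subsingleton_in_edges hG hU
  choose v hv using fun x => exists_shortest_path hG x x0
  have hloop {x : V} (l l' : Path x x) : c l l' = 0 := by
    refine hc.eq_zero_of_commute hM l l' ?_
    exact eq_of_heq (Sigma.mk.inj (path_unique hU (l.comp l') (l'.comp l) (by simp [add_comm]))).2
  refine ⟨fun x g => -c (v x) (g.comp (v x)), fun x y e u => ?_, fun x n => ?_⟩
  · have hA : Function.extend (fun g : Path y x0 => e.toPath.comp g) (c (v y)) 0 (u.comp (v y)) =
        -Function.extend (fun g : Path y y => e.toPath.comp g)
          (fun g => -c (v y) (g.comp (v y))) 0 u := by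
      by_cases hg : ∃ g, e.toPath.comp g = u
      · obtain ⟨g, rfl⟩ := hg
        rw [Path.comp_assoc, extend_comp_left, extend_comp_left, neg_neg]
      · rw [extend_eq_zero (b := u) _ _ fun g hg' => hg ⟨g, hg'⟩, neg_zero]
        refine extend_eq_zero _ _ _ fun q hq => ?_
        rcases Nat.eq_zero_or_pos u.length with h0 | h0
        · obtain rfl := Path.eq_of_length_zero u h0
          obtain rfl := Path.eq_nil_of_length_zero u h0
          have h1 := hv x q
          have h2 := congrArg Path.length hq
          simp at h2
          omega
        · obtain ⟨g, hg', -⟩ := levi _ _ _ _ hq h0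
          exact hg ⟨g, hg'.symm⟩
    obtain ⟨l, hl⟩ := exists_eq_comp hU (v x) (e.toPath.comp (v y)) (hv x _)
    have hB : Function.extend (fun g : Path x x0 => g.comp l) (c (v x)) 0 (u.comp (v y)) =
        -Function.extend (fun g : Path x x => g.comp e.toPath)
          (fun g => -c (v x) (g.comp (v x))) 0 u := by
      by_cases hg : ∃ g : Path x x, g.comp e.toPath = u
      · obtain ⟨g, rfl⟩ := hg
        rw [Path.comp_assoc, hl, ← Path.comp_assoc, extend_comp_right, extend_comp_right, neg_neg]
      · rw [extend_eq_zero (b := u) _ _ fun g hg' => hg ⟨g, hg'⟩, neg_zero]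
        refine extend_eq_zero _ _ _ fun q hq => ?_
        obtain ⟨g, rfl⟩ := exists_eq_comp' hI (v x) q (hv x q)
        rw [Path.comp_assoc, ← hl, ← Path.comp_assoc, Path.comp_inj_left] at hq
        exact hg ⟨g, hq⟩
    have h1 : c (e.toPath.comp (v y)) (u.comp (v y)) =
        Function.extend (fun g : Path x x0 => g.comp l) (c (v x)) 0 (u.comp (v y)) := by
      have h0 : c l = 0 := funext fun l' => hloop l l'
      rw [hl, hc, Pi.add_apply, h0]
      have : Function.extend (fun g : Path x0 x0 => (v x).comp g) (0 : Path x0 x0 → ℂ) 0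
          (u.comp (v y)) = 0 := by
        by_cases hq : ∃ q, (v x).comp q = u.comp (v y)
        · obtain ⟨q, hq⟩ := hq
          rw [← hq, extend_comp_left, Pi.zero_apply]
        · exact extend_eq_zero _ _ _ fun q hq' => hq ⟨q, hq'⟩
      rw [this, zero_add]
    rw [hB, hc, Pi.add_apply, extend_comp_right, hA] at h1
    linear_combination h1
  · refine ⟨x0, v x, fun s u w _ _ => ?_⟩
    by_cases hg : ∃ g, w.comp g = u
    · obtain ⟨g, rfl⟩ := hg
      rw [Path.comp_assoc, extend_comp_left, extend_comp_left]
    · rw [extend_eq_zero (b := u) _ _ fun g hg' => hg ⟨g, hg'⟩, neg_eq_zero]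
      refine extend_eq_zero _ _ _ fun q hq => ?_
      rcases le_total w.length u.length with hl | hl
      · obtain ⟨g, hg', -⟩ := levi _ _ _ _ hq hl
        exact hg ⟨g, hg'.symm⟩
      · obtain ⟨g, rfl, hgv⟩ := levi _ _ _ _ hq.symm hl
        have h1 := hv x q
        rw [hgv, Path.length_comp] at h1
        obtain rfl := Path.eq_nil_of_length_zero g (by omega)
        exact hg ⟨Path.nil, rfl⟩

theorem exists_potential [Finite V] (hG : IsStronglyConnected V) : ∃ τ, IsPotential c τ := by
  by_cases hU : ∀ z : V, Subsingleton (Σ b, z ⟶ b)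
  · rcases isEmpty_or_nonempty V with hV | ⟨⟨x0⟩⟩
    · exact ⟨fun x => isEmptyElim x, fun x => isEmptyElim x, fun x => isEmptyElim x⟩
    · exact hc.exists_potential_of_cycle hM hG hU x0
  · push Not at hU
    obtain ⟨z, hz⟩ := hU
    obtain ⟨⟨a, f⟩, ⟨a', f'⟩, hf⟩ := hz
    exact hc.exists_potential_of_branching hM hG f f' hf

end IsPathCocycle

end CycleGraph

end FreeSemigroupoid

namespace FreeSemigroupoid

/-! ### Operators on `ℓ²`: matrices and weak limits. -/

noncomputable section ShiftOperators

open scoped lp InnerProductSpace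
open Quiver Filter Topology

section Shift

variable {ι κ : Type*}

/-- The operator on `ℓ²(ι)` that moves the basis vector at `j a` to the basis vector at `k a`, and
annihilates the basis vectors off the range of `j`. -/
def shiftOp (j k : κ → ι) (hj : Function.Injective j) (hk : Function.Injective k) :
    ℓ²(ι, ℂ) →L[ℂ] ℓ²(ι, ℂ) :=
  partialShift (s := Set.range j) (fun u => k ((Equiv.ofInjective j hj).symm u))
    (hk.comp (Equiv.injective _))

variable {j k : κ → ι} (hj : Function.Injective j) (hk : Function.Injective k)

theorem norm_partialShift_le {s : Set ι} (g : s → ι) (hg : Function.Injective g) :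
    ‖partialShift g hg‖ ≤ 1 := by
  unfold partialShift
  exact LinearMap.mkContinuous_norm_le _ zero_le_one _

theorem norm_shiftOp_le : ‖shiftOp j k hj hk‖ ≤ 1 := norm_partialShift_le _ _

theorem shiftOp_apply (f : ℓ²(ι, ℂ)) (a : κ) : shiftOp j k hj hk f (k a) = f (j a) := by
  have h := (hk.comp (Equiv.ofInjective j hj).symm.injective).extend_apply
    (fun u : Set.range j => f u) (0 : ι → ℂ) (Equiv.ofInjective j hj a)
  rw [Function.comp_apply, Equiv.symm_apply_apply] at h
  exact h

theorem shiftOp_apply_eq_zero (f : ℓ²(ι, ℂ)) (b : ι) (hb : ∀ a, k a ≠ b) :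
    shiftOp j k hj hk f b = 0 := by
  rw [shiftOp, partialShift_coe]
  exact Function.extend_apply' _ _ _ fun ⟨a, ha⟩ => hb _ ha

end Shift

variable {V : Type*} [Quiver V]

theorem shiftOp_basisVec {κ : Type*} {j k : κ → PathSpace V} (hj : Function.Injective j)
    (hk : Function.Injective k) (a : κ) : shiftOp j k hj hk (basisVec (j a)) = basisVec (k a) := by
  have := partialShift_basisVec_of_mem (fun u => k ((Equiv.ofInjective j hj).symm u))
    (hk.comp (Equiv.injective _)) (Equiv.ofInjective j hj a)
  rw [Equiv.symm_apply_apply] at this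
  exact this

theorem shiftOp_basisVec_of_ne {κ : Type*} {j k : κ → PathSpace V} (hj : Function.Injective j)
    (hk : Function.Injective k) {w : PathSpace V} (hw : ∀ a, j a ≠ w) :
    shiftOp j k hj hk (basisVec w) = 0 :=
  partialShift_basisVec_of_notMem _ _ fun ⟨a, ha⟩ => hw a ha

theorem basisVec_apply_self (w : PathSpace V) : basisVec w w = 1 := by
  simp [basisVec]

theorem basisVec_apply_of_ne {u w : PathSpace V} (h : u ≠ w) : basisVec w u = 0 := by
  simp [basisVec, h]

theorem norm_basisVec (w : PathSpace V) : ‖basisVec w‖ = 1 := by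
  classical
  rw [basisVec, lp.norm_single (by norm_num), norm_one]

theorem inner_basisVec_left (w : PathSpace V) (f : PathHilbert V) : ⟪basisVec w, f⟫_ℂ = f w := by
  classical
  rw [basisVec, lp.inner_single_left]
  simp

theorem hasSum_basisVec (f : PathHilbert V) : HasSum (fun w => f w • basisVec w) f := by
  classical
  have h := lp.hasSum_single (p := 2) (by norm_num) f
  convert h using 2 with w
  ext u
  by_cases hu : u = w
  · subst hu
    simp [basisVec]
  · simp [basisVec, hu]

theorem ext_basisVec {F : Type*} [AddCommMonoid F] [Module ℂ F] [TopologicalSpace F] [T2Space F]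
    {A B : PathHilbert V →L[ℂ] F} (h : ∀ w, A (basisVec w) = B (basisVec w)) : A = B := by
  ext f
  have hA := (hasSum_basisVec f).mapL A
  have hB := (hasSum_basisVec f).mapL B
  simp only [map_smul, h] at hA hB
  exact hA.unique hB

/-- The norm bound allows `f` to be replaced by a finite combination of basis vectors with an error
uniform in `i`. -/
theorem tendsto_of_basisVec {α : Type*} {l : Filter α} {φ : α → PathHilbert V →L[ℂ] ℂ}
    {ψ : PathHilbert V →L[ℂ] ℂ} {C : ℝ} (hφ : ∀ i, ‖φ i‖ ≤ C)
    (h : ∀ w, Tendsto (fun i => φ i (basisVec w)) l (𝓝 (ψ (basisVec w)))) (f : PathHilbert V) :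
    Tendsto (fun i => φ i f) l (𝓝 (ψ f)) := by
  rw [Metric.tendsto_nhds]
  intro ε hε
  set K := |C| + ‖ψ‖ + 1 with hK
  have hKpos : 0 < K := by positivity
  obtain ⟨S, hS⟩ := ((Metric.tendsto_nhds.1 (hasSum_basisVec f)) (ε / (2 * K)) (by positivity)).exists
  set g := ∑ w ∈ S, f w • basisVec w with hg
  have hlim : Tendsto (fun i => φ i g) l (𝓝 (ψ g)) := by
    simp only [hg, map_sum, map_smul]
    exact tendsto_finsetSum _ fun w _ => (h w).const_smul _
  filter_upwards [Metric.tendsto_nhds.1 hlim (ε / 2) (by positivity)] with i hi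
  have h1 : φ i f - ψ f = (φ i g - ψ g) - (φ i - ψ) (g - f) := by
    simp only [_root_.sub_apply, map_sub]
    ring
  rw [dist_eq_norm] at hi hS ⊢
  rw [h1]
  have h2 : ‖(φ i - ψ) (g - f)‖ ≤ K * (ε / (2 * K)) := by
    refine (ContinuousLinearMap.le_opNorm _ _).trans ?_
    refine mul_le_mul ?_ hS.le (norm_nonneg _) hKpos.le
    refine (norm_sub_le _ _).trans ?_
    linarith [hφ i, le_abs_self C]
  have h3 : K * (ε / (2 * K)) = ε / 2 := by field_simp
  linarith [norm_sub_le (φ i g - ψ g) ((φ i - ψ) (g - f))]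

/-- A matrix whose finite pieces are pieces of operators of norm at most `C` is the matrix of an
operator of norm at most `C`. -/
theorem exists_operator_of_matrix (a : PathSpace V → PathSpace V → ℂ) (C : ℝ)
    (h : ∀ S : Finset (PathSpace V), ∃ B : PathHilbert V →L[ℂ] PathHilbert V, ‖B‖ ≤ C ∧
      ∀ u ∈ S, ∀ w ∈ S, B (basisVec w) u = a u w) :
    ∃ T : PathHilbert V →L[ℂ] PathHilbert V, ‖T‖ ≤ C ∧ ∀ u w, T (basisVec w) u = a u w := by
  classical
  choose B hB hBa using h
  have hC : 0 ≤ C := (norm_nonneg _).trans (hB ∅)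
  -- Along an ultrafilter all the bounded coordinates `B S f u` converge at once, with no
  -- countability of the path space needed.
  let U : Ultrafilter (Finset (PathSpace V)) := Ultrafilter.of atTop
  have hU : (U : Filter (Finset (PathSpace V))) ≤ atTop := Ultrafilter.of_le atTop
  have hbound (S : Finset (PathSpace V)) (f : PathHilbert V) : ‖B S f‖ ≤ C * ‖f‖ :=
    ((B S).le_opNorm f).trans (mul_le_mul_of_nonneg_right (hB S) (norm_nonneg f))
  have hlim (f : PathHilbert V) (u : PathSpace V) :
      ∃ z, Tendsto (fun S => B S f u) U (𝓝 z) := by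
    have hcpt := isCompact_closedBall (0 : ℂ) (C * ‖f‖)
    obtain ⟨z, -, hz⟩ := hcpt.ultrafilter_le_nhds (U.map fun S => B S f u) (by
      rw [le_principal_iff]
      refine mem_map.2 (univ_mem' fun S => ?_)
      rw [Set.mem_preimage, mem_closedBall_zero_iff]
      exact (lp.norm_apply_le_norm (by norm_num) _ _).trans (hbound S f))
    exact ⟨z, hz⟩
  choose L hL using hlim
  have hLpi (f : PathHilbert V) :
      Tendsto (id fun S => B S f : Finset (PathSpace V) → ∀ _ : PathSpace V, ℂ) U (𝓝 (L f)) :=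
    tendsto_pi_nhds.2 fun u => hL f u
  have hmem (f : PathHilbert V) : Memℓp (L f) 2 := by
    refine lp.memℓp_of_tendsto (F := fun S => B S f) ?_ (hLpi f)
    refine isBounded_iff_forall_norm_le.2 ⟨C * ‖f‖, ?_⟩
    rintro _ ⟨S, rfl⟩
    exact hbound S f
  let T : PathHilbert V →L[ℂ] PathHilbert V := LinearMap.mkContinuous
    { toFun := fun f => ⟨L f, hmem f⟩
      map_add' := fun f g => by
        ext u
        refine tendsto_nhds_unique (hL (f + g) u) ?_
        simp only [map_add]
        exact (hL f u).add (hL g u)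
      map_smul' := fun c f => by
        ext u
        refine tendsto_nhds_unique (hL (c • f) u) ?_
        simp only [map_smul]
        exact (hL f u).const_smul c }
    C (fun f => lp.norm_le_of_tendsto (F := fun S => B S f)
      (Eventually.of_forall fun S => hbound S f) (hLpi f))
  refine ⟨T, LinearMap.mkContinuous_norm_le _ hC _, fun u w => ?_⟩
  refine tendsto_nhds_unique (hL (basisVec w) u) ?_
  refine tendsto_const_nhds.congr' ?_
  filter_upwards [hU (eventually_ge_atTop {u, w})] with S hS
  exact (hBa S u (hS (by simp)) w (hS (by simp))).symm

/-- For bounded families, entrywise convergence is weak operator convergence: `tendsto_of_basisVec`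
is used in one variable of the inner product, then in the other. -/
theorem mem_leftFreeSemigroupoidAlgebra_of_tendsto {α : Type*} {l : Filter α} [l.NeBot]
    {A : α → PathHilbert V →L[ℂ] PathHilbert V} {T : PathHilbert V →L[ℂ] PathHilbert V} {C : ℝ}
    (hA : ∀ i, ‖A i‖ ≤ C) (hmem : ∀ i, A i ∈ leftFreeSemigroupoidAlgebra V)
    (h : ∀ u w, Tendsto (fun i => A i (basisVec w) u) l (𝓝 (T (basisVec w) u))) :
    T ∈ leftFreeSemigroupoidAlgebra V := by
  rw [mem_leftFreeSemigroupoidAlgebra_iff]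
  refine isClosed_closure.mem_of_tendsto (f := fun i => ContinuousLinearMapWOT.ofCLM (A i)) (b := l)
    ?_ (Eventually.of_forall fun i => (mem_leftFreeSemigroupoidAlgebra_iff V _).1 (hmem i))
  rw [ContinuousLinearMapWOT.tendsto_iff_forall_inner_apply_tendsto]
  intro f g
  simp only [ContinuousLinearMapWOT.ofCLM_apply]
  have h1 (u : PathSpace V) : Tendsto (fun i => A i f u) l (𝓝 (T f u)) := by
    have := tendsto_of_basisVec (l := l) (φ := fun i => (innerSL ℂ (basisVec u)).comp (A i))
      (ψ := (innerSL ℂ (basisVec u)).comp T) (C := C) (fun i => ?_) (fun w => ?_) f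
    · simpa [inner_basisVec_left] using this
    · refine (ContinuousLinearMap.opNorm_comp_le _ _).trans ?_
      rw [innerSL_apply_norm, norm_basisVec, one_mul]
      exact hA i
    · simpa [inner_basisVec_left] using h u w
  have h2 := tendsto_of_basisVec (l := l) (φ := fun i => innerSL ℂ (A i f)) (ψ := innerSL ℂ (T f))
    (C := C * ‖f‖) (fun i => ?_) (fun w => ?_) g
  · have h3 := (Complex.continuous_conj.tendsto _).comp h2
    simpa [Function.comp_def, inner_conj_symm] using h3
  · rw [innerSL_apply_norm]
    exact ((A i).le_opNorm f).trans (mul_le_mul_of_nonneg_right (hA i) (norm_nonneg f))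
  · have h3 := (Complex.continuous_conj.tendsto _).comp (h1 w)
    have h4 (x : PathHilbert V) : ⟪x, basisVec w⟫_ℂ = (starRingEnd ℂ) (x w) := by
      rw [← inner_basisVec_left, inner_conj_symm]
    simpa [Function.comp_def, h4] using h3

end ShiftOperators

end FreeSemigroupoid

namespace FreeSemigroupoid

/-! ### Left and right multiplications by paths. -/

noncomputable section PathOperators

open scoped lp InnerProductSpace
open Quiver Filter Topology

variable {V : Type*} [Quiver V]

/-- Prolongation of the paths with range `y` by the path `v`. -/
def prolong {y z : V} (v : Path y z) (p : Σ s : V, Path s y) : PathSpace V := ⟨p.1, z, p.2.comp v⟩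

theorem prolong_injective {y z : V} (v : Path y z) : Function.Injective (prolong v) := by
  rintro ⟨s, p⟩ ⟨s', p'⟩ h
  obtain ⟨rfl, h⟩ := Sigma.mk.inj h
  have h := eq_of_heq (Sigma.mk.inj (eq_of_heq h)).2
  rw [Path.comp_inj_left] at h
  exact Sigma.ext rfl (heq_of_eq h)

/-- Precomposition of the paths with source `y` with the path `w`. -/
def precompose {x y : V} (w : Path x y) (p : Σ z : V, Path y z) : PathSpace V :=
  ⟨x, p.1, w.comp p.2⟩

theorem precompose_injective {x y : V} (w : Path x y) : Function.Injective (precompose w) := by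
  rintro ⟨z, p⟩ ⟨z', p'⟩ h
  have h := eq_of_heq (Sigma.mk.inj h).2
  obtain ⟨rfl, h⟩ := Sigma.mk.inj h
  have h := eq_of_heq h
  rw [Path.comp_inj_right] at h
  exact Sigma.ext rfl (heq_of_eq h)

theorem pathsFrom_injective (y : V) :
    Function.Injective fun p : Σ z : V, Path y z => (⟨y, p.1, p.2⟩ : PathSpace V) := by
  rintro ⟨z, p⟩ ⟨z', p'⟩ h
  exact eq_of_heq (Sigma.mk.inj h).2

/-- The operator `L_v` of a path `v`. -/
def pathOp {y z : V} (v : Path y z) : PathHilbert V →L[ℂ] PathHilbert V :=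
  shiftOp (prolong Path.nil) (prolong v) (prolong_injective _) (prolong_injective _)

/-- The adjoint of `L_v`. -/
def copathOp {y z : V} (v : Path y z) : PathHilbert V →L[ℂ] PathHilbert V :=
  shiftOp (prolong v) (prolong Path.nil) (prolong_injective _) (prolong_injective _)

/-- The operator of right multiplication by a path `w`: it maps `ξ_p` to `ξ_{pw}`. -/
def rightOp {x y : V} (w : Path x y) : PathHilbert V →L[ℂ] PathHilbert V :=
  shiftOp _ (precompose w) (pathsFrom_injective y) (precompose_injective w)

theorem norm_pathOp_le {y z : V} (v : Path y z) : ‖pathOp v‖ ≤ 1 := norm_shiftOp_le _ _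

theorem norm_copathOp_le {y z : V} (v : Path y z) : ‖copathOp v‖ ≤ 1 := norm_shiftOp_le _ _

theorem pathOp_apply {y z : V} (v : Path y z) (f : PathHilbert V) (s : V) (u : Path s z) :
    pathOp v f ⟨s, z, u⟩ =
      Function.extend (fun p : Path s y => p.comp v) (fun p => f ⟨s, y, p⟩) 0 u := by
  by_cases h : ∃ p : Path s y, p.comp v = u
  · obtain ⟨p, rfl⟩ := h
    rw [extend_comp_right]
    exact shiftOp_apply _ _ f (⟨s, p⟩ : Σ s, Path s y)
  · rw [extend_eq_zero _ _ _ fun p hp => h ⟨p, hp⟩]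
    refine shiftOp_apply_eq_zero _ _ _ _ fun ⟨s', p⟩ hp => ?_
    obtain ⟨rfl, hp⟩ := Sigma.mk.inj hp
    exact h ⟨p, eq_of_heq (Sigma.mk.inj (eq_of_heq hp)).2⟩

theorem pathOp_apply_comp {y z : V} (v : Path y z) (f : PathHilbert V) {s : V} (p : Path s y) :
    pathOp v f ⟨s, z, p.comp v⟩ = f ⟨s, y, p⟩ := by
  rw [pathOp_apply, extend_comp_right]

theorem pathOp_apply_of_ne {y z : V} (v : Path y z) (f : PathHilbert V) {u : PathSpace V}
    (hu : u.range ≠ z) : pathOp v f u = 0 :=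
  shiftOp_apply_eq_zero _ _ _ _ fun _ hp => hu (by rw [← hp]; rfl)

theorem copathOp_apply {y z : V} (v : Path y z) (f : PathHilbert V) {s : V} (p : Path s y) :
    copathOp v f ⟨s, y, p⟩ = f ⟨s, z, p.comp v⟩ :=
  shiftOp_apply (k := prolong Path.nil) (prolong_injective _) (prolong_injective _) f
    (⟨s, p⟩ : Σ s, Path s y)

theorem copathOp_apply_of_ne {y z : V} (v : Path y z) (f : PathHilbert V) {u : PathSpace V}
    (hu : u.range ≠ y) : copathOp v f u = 0 :=
  shiftOp_apply_eq_zero _ _ _ _ fun _ hp => hu (by rw [← hp]; rfl)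

theorem rightOp_apply {x y : V} (w : Path x y) (f : PathHilbert V) (z : V) (u : Path x z) :
    rightOp w f ⟨x, z, u⟩ =
      Function.extend (fun p : Path y z => w.comp p) (fun p => f ⟨y, z, p⟩) 0 u := by
  by_cases h : ∃ p : Path y z, w.comp p = u
  · obtain ⟨p, rfl⟩ := h
    rw [extend_comp_left]
    exact shiftOp_apply (k := precompose w) (pathsFrom_injective y) (precompose_injective w) f ⟨z, p⟩
  · rw [extend_eq_zero _ _ _ fun p hp => h ⟨p, hp⟩]
    refine shiftOp_apply_eq_zero _ _ _ _ fun ⟨z', p⟩ hp => ?_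
    have hp := eq_of_heq (Sigma.mk.inj hp).2
    obtain ⟨rfl, hp⟩ := Sigma.mk.inj hp
    exact h ⟨p, eq_of_heq hp⟩

theorem rightOp_apply_of_ne {x y : V} (w : Path x y) (f : PathHilbert V) {u : PathSpace V}
    (hu : u.source ≠ x) : rightOp w f u = 0 :=
  shiftOp_apply_eq_zero _ _ _ _ fun _ hp => hu (by rw [← hp]; rfl)

theorem pathOp_basisVec {s y z : V} (v : Path y z) (p : Path s y) :
    pathOp v (basisVec ⟨s, y, p⟩) = basisVec ⟨s, z, p.comp v⟩ :=
  shiftOp_basisVec (j := prolong Path.nil) (prolong_injective _) (prolong_injective v)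
    (⟨s, p⟩ : Σ s, Path s y)

theorem pathOp_basisVec_of_ne {y z : V} (v : Path y z) {w : PathSpace V} (h : w.range ≠ y) :
    pathOp v (basisVec w) = 0 :=
  shiftOp_basisVec_of_ne _ _ fun _ ha => h (by rw [← ha]; rfl)

theorem rightOp_basisVec {x y z : V} (w : Path x y) (p : Path y z) :
    rightOp w (basisVec ⟨y, z, p⟩) = basisVec ⟨x, z, w.comp p⟩ :=
  shiftOp_basisVec (pathsFrom_injective y) (precompose_injective w) (⟨z, p⟩ : Σ z, Path y z)

theorem rightOp_basisVec_of_ne {x y : V} (w : Path x y) {p : PathSpace V} (h : p.source ≠ y) :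
    rightOp w (basisVec p) = 0 :=
  shiftOp_basisVec_of_ne _ _ fun _ ha => h (by rw [← ha]; rfl)

theorem pathOp_nil (x : V) : pathOp (Path.nil : Path x x) = vertexOp x := by
  refine ext_basisVec fun ⟨s, t, p⟩ => ?_
  by_cases h : t = x
  · subst h
    rw [pathOp_basisVec]
    exact (vertexOp_basisVec ⟨s, t, p⟩).symm
  · rw [pathOp_basisVec_of_ne _ (w := ⟨s, t, p⟩) h, vertexOp_basisVec_of_ne (w := ⟨s, t, p⟩) h]

theorem pathOp_toPath {x y : V} (e : x ⟶ y) : pathOp e.toPath = edgeOp e := by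
  refine ext_basisVec fun ⟨s, t, p⟩ => ?_
  by_cases h : t = x
  · subst h
    rw [pathOp_basisVec, edgeOp_basisVec]
    rfl
  · rw [pathOp_basisVec_of_ne _ (w := ⟨s, t, p⟩) h, edgeOp_basisVec_of_ne _ (w := ⟨s, t, p⟩) h]

theorem pathOp_comp {x y z : V} (w : Path x y) (v : Path y z) :
    pathOp (w.comp v) = pathOp v * pathOp w := by
  refine ext_basisVec fun ⟨s, t, p⟩ => ?_
  rw [mul_apply_eq_comp]
  by_cases h : t = x
  · subst h
    rw [pathOp_basisVec, pathOp_basisVec, pathOp_basisVec, Path.comp_assoc]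
  · rw [pathOp_basisVec_of_ne _ (w := ⟨s, t, p⟩) h, pathOp_basisVec_of_ne _ (w := ⟨s, t, p⟩) h,
      map_zero]

theorem pathOp_mul_rightOp {x y a b : V} (v : Path x y) (w : Path a b) :
    pathOp v * rightOp w = rightOp w * pathOp v := by
  refine ext_basisVec fun ⟨s, t, p⟩ => ?_
  rw [mul_apply_eq_comp, mul_apply_eq_comp]
  by_cases h : t = x
  · subst h
    by_cases h' : s = b
    · subst h'
      rw [pathOp_basisVec, rightOp_basisVec, rightOp_basisVec, pathOp_basisVec, Path.comp_assoc]
    · rw [pathOp_basisVec, rightOp_basisVec_of_ne _ (p := ⟨s, t, p⟩) h',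
        rightOp_basisVec_of_ne _ (p := ⟨s, y, p.comp v⟩) h', map_zero]
  · rw [pathOp_basisVec_of_ne _ (w := ⟨s, t, p⟩) h, map_zero]
    by_cases h' : s = b
    · subst h'
      rw [rightOp_basisVec, pathOp_basisVec_of_ne _ (w := ⟨a, t, w.comp p⟩) h]
    · rw [rightOp_basisVec_of_ne _ (p := ⟨s, t, p⟩) h', map_zero]

theorem pathOp_mem {x y : V} (v : Path x y) : pathOp v ∈ algebraicPart V := by
  induction v with
  | nil =>
    rw [pathOp_nil]
    exact NonUnitalAlgebra.subset_adjoin ℂ (Or.inr ⟨_, rfl⟩)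
  | cons v e ih =>
    rw [← Path.comp_toPath_eq_cons, pathOp_comp, pathOp_toPath]
    exact mul_mem (NonUnitalAlgebra.subset_adjoin ℂ (Or.inl ⟨_, _, e, rfl⟩)) ih

theorem algebraicPart_le : algebraicPart V ≤ tensorAlgebra V :=
  NonUnitalSubalgebra.le_topologicalClosure _

/-- The operators that commute with all right multiplications. -/
def RightInvariant (A : PathHilbert V →L[ℂ] PathHilbert V) : Prop :=
  ∀ ⦃x y : V⦄ (w : Path x y), A * rightOp w = rightOp w * A

theorem rightInvariant_of_mem_algebraicPart {A : PathHilbert V →L[ℂ] PathHilbert V}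
    (hA : A ∈ algebraicPart V) : RightInvariant A := by
  intro x y w
  have h : algebraicPart V ≤ NonUnitalSubalgebra.centralizer ℂ {rightOp w} := by
    refine NonUnitalAlgebra.adjoin_le ?_
    rintro _ (⟨x, y, e, rfl⟩ | ⟨x, rfl⟩)
    · rw [← pathOp_toPath]
      rintro _ rfl
      exact (pathOp_mul_rightOp _ _).symm
    · rw [← pathOp_nil]
      rintro _ rfl
      exact (pathOp_mul_rightOp _ _).symm
  exact (h hA _ rfl).symm

/-- Left and right multiplications commute, and a commutant is closed in the weak operator topology.
For finitely many vertices `mem_of_rightInvariant` is the converse. -/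
theorem rightInvariant_of_mem {A : PathHilbert V →L[ℂ] PathHilbert V}
    (hA : A ∈ leftFreeSemigroupoidAlgebra V) : RightInvariant A := by
  intro x y w
  rw [mem_leftFreeSemigroupoidAlgebra_iff] at hA
  have h : closure (ContinuousLinearMapWOT.ofCLM '' (algebraicPart V : Set _)) ⊆
      Set.centralizer {ContinuousLinearMapWOT.ofCLM (rightOp w)} := by
    refine closure_minimal ?_ (Set.isClosed_centralizer _)
    rintro _ ⟨B, hB, rfl⟩ _ rfl
    rw [← ContinuousLinearMapWOT.ofCLM_mul, ← ContinuousLinearMapWOT.ofCLM_mul,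
      rightInvariant_of_mem_algebraicPart hB w]
  have h1 := h hA _ rfl
  rw [← ContinuousLinearMapWOT.ofCLM_mul, ← ContinuousLinearMapWOT.ofCLM_mul] at h1
  exact (ContinuousLinearMapWOT.ofCLM_injective h1).symm

namespace RightInvariant

variable {A B : PathHilbert V →L[ℂ] PathHilbert V}

theorem apply_basisVec (hA : RightInvariant A) {s x : V} (p : Path s x) :
    A (basisVec ⟨s, x, p⟩) = rightOp p (A (basisVec ⟨x, x, Path.nil⟩)) := by
  have h := congrArg (fun T => T (basisVec ⟨x, x, Path.nil⟩)) (hA p)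
  simp only [mul_apply_eq_comp] at h
  rw [rightOp_basisVec, Path.comp_nil] at h
  exact h

theorem ext (hA : RightInvariant A) (hB : RightInvariant B)
    (h : ∀ x : V, A (basisVec ⟨x, x, Path.nil⟩) = B (basisVec ⟨x, x, Path.nil⟩)) : A = B := by
  refine ext_basisVec fun ⟨s, x, p⟩ => ?_
  rw [hA.apply_basisVec, hB.apply_basisVec, h]

theorem apply_basisVec_apply (hA : RightInvariant A) {s x y : V} (p : Path s x) (u : Path s y) :
    A (basisVec ⟨s, x, p⟩) ⟨s, y, u⟩ = Function.extend (fun g : Path x y => p.comp g)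
      (fun g => A (basisVec ⟨x, x, Path.nil⟩) ⟨x, y, g⟩) 0 u := by
  rw [hA.apply_basisVec, rightOp_apply]

theorem apply_basisVec_apply_of_ne (hA : RightInvariant A) {w u : PathSpace V}
    (h : u.source ≠ w.source) : A (basisVec w) u = 0 := by
  obtain ⟨s, x, p⟩ := w
  rw [hA.apply_basisVec]
  exact rightOp_apply_of_ne _ _ h

theorem add (hA : RightInvariant A) (hB : RightInvariant B) : RightInvariant (A + B) :=
  fun x y w => by rw [add_mul, mul_add, hA w, hB w]

theorem sub (hA : RightInvariant A) (hB : RightInvariant B) : RightInvariant (A - B) :=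
  fun x y w => by rw [sub_mul, mul_sub, hA w, hB w]

theorem mul (hA : RightInvariant A) (hB : RightInvariant B) : RightInvariant (A * B) :=
  fun x y w => by rw [mul_assoc, hB w, ← mul_assoc, hA w, mul_assoc]

end RightInvariant

theorem rightInvariant_pathOp {x y : V} (v : Path x y) : RightInvariant (pathOp v) :=
  fun _ _ w => pathOp_mul_rightOp v w

/-- An operator whose matrix is that of a right multiplication invariant operator is one. -/
theorem rightInvariant_of_apply {A : PathHilbert V →L[ℂ] PathHilbert V}
    (h0 : ∀ w u : PathSpace V, u.source ≠ w.source → A (basisVec w) u = 0)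
    (τ : ∀ x y : V, Path x y → ℂ)
    (h : ∀ (s x y : V) (p : Path s x) (u : Path s y), A (basisVec ⟨s, x, p⟩) ⟨s, y, u⟩ =
      Function.extend (fun g : Path x y => p.comp g) (τ x y) 0 u) : RightInvariant A := by
  have key {s x : V} (p : Path s x) :
      A (basisVec ⟨s, x, p⟩) = rightOp p (A (basisVec ⟨x, x, Path.nil⟩)) := by
    ext ⟨s', y, u⟩
    by_cases hs : s' = s
    · subst hs
      rw [h, rightOp_apply]
      congr 1
      funext g
      rw [h]
      have := extend_comp_left (Path.nil : Path x x) (τ x y) g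
      rw [Path.nil_comp] at this
      exact this.symm
    · exact (h0 ⟨s, x, p⟩ ⟨s', y, u⟩ hs).trans (rightOp_apply_of_ne _ _ (u := ⟨s', y, u⟩) hs).symm
  have rightOp_comp {a b d : V} (w : Path a b) (v : Path b d) :
      rightOp (w.comp v) = rightOp w * rightOp v := by
    refine ext_basisVec fun ⟨s, t, p⟩ => ?_
    rw [mul_apply_eq_comp]
    by_cases hs : s = d
    · subst hs
      rw [rightOp_basisVec, rightOp_basisVec, rightOp_basisVec, Path.comp_assoc]
    · rw [rightOp_basisVec_of_ne _ (p := ⟨s, t, p⟩) hs,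
        rightOp_basisVec_of_ne _ (p := ⟨s, t, p⟩) hs, map_zero]
  intro a b w
  refine ext_basisVec fun ⟨s, t, p⟩ => ?_
  rw [mul_apply_eq_comp, mul_apply_eq_comp]
  by_cases hs : s = b
  · subst hs
    rw [rightOp_basisVec, key, key p, rightOp_comp, mul_apply_eq_comp]
  · rw [rightOp_basisVec_of_ne _ (p := ⟨s, t, p⟩) hs, map_zero]
    symm
    ext ⟨s', y, u⟩
    by_cases hs' : s' = a
    · subst hs'
      rw [rightOp_apply]
      have : (fun g : Path b y => A (basisVec ⟨s, t, p⟩) ⟨b, y, g⟩) = 0 :=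
        funext fun g => h0 _ _ fun h => hs h.symm
      rw [this]
      by_cases hu : ∃ g : Path b y, w.comp g = u
      · obtain ⟨g, rfl⟩ := hu
        rw [extend_comp_left]
        rfl
      · exact extend_eq_zero _ _ _ fun g hg => hu ⟨g, hg⟩
    · exact rightOp_apply_of_ne _ _ hs'

end PathOperators

end FreeSemigroupoid

namespace FreeSemigroupoid

/-! ### Fejér means and the commutant of the right multiplications. -/

noncomputable section Fejer

open scoped lp InnerProductSpace
open Quiver Filter Topology

variable {V : Type*} [Quiver V]

/-- The length of an element of the path space. -/
def PathSpace.length (w : PathSpace V) : ℕ := w.2.2.length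

/-- The coefficient of `g` in the Fourier series of `A`. -/
def fourierCoeff (A : PathHilbert V →L[ℂ] PathHilbert V) (g : PathSpace V) : ℂ :=
  A (basisVec ⟨g.1, g.1, Path.nil⟩) g

section Window

/-- The projection onto the span of the basis vectors `ξ_w` with `|w| ≤ m < |w| + n`. -/
def windowProj (n m : ℕ) : PathHilbert V →L[ℂ] PathHilbert V :=
  partialShift (s := {w : PathSpace V | w.length ≤ m ∧ m < w.length + n}) Subtype.val
    Subtype.val_injective

theorem windowProj_apply (n m : ℕ) (f : PathHilbert V) (w : PathSpace V) :
    windowProj n m f w = if w.length ≤ m ∧ m < w.length + n then f w else 0 := by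
  split_ifs with h
  · exact Subtype.val_injective.extend_apply
      (fun u : {w : PathSpace V | w.length ≤ m ∧ m < w.length + n} => f u) 0 ⟨w, h⟩
  · rw [windowProj, partialShift_coe]
    refine Function.extend_apply' _ _ _ ?_
    rintro ⟨a, rfl⟩
    exact h a.2

theorem inner_windowProj (n m : ℕ) (f g : PathHilbert V) :
    ⟪f, windowProj n m g⟫_ℂ = ⟪windowProj n m f, g⟫_ℂ := by
  rw [lp.inner_eq_tsum, lp.inner_eq_tsum]
  refine tsum_congr fun w => ?_
  rw [windowProj_apply, windowProj_apply]
  split_ifs <;> simp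

theorem hasSum_norm_sq (f : PathHilbert V) : HasSum (fun w => ‖f w‖ ^ 2) (‖f‖ ^ 2) := by
  simpa using lp.hasSum_norm (p := 2) (by norm_num) f

/-- A path of length `k` lies in the window only for `k ≤ m < k + n`, that is, for at most `n`
indices. -/
theorem sum_norm_windowProj_sq_le (n N : ℕ) (f : PathHilbert V) :
    ∑ m ∈ Finset.range N, ‖windowProj n m f‖ ^ 2 ≤ n * ‖f‖ ^ 2 := by
  refine hasSum_le (fun w => ?_) (hasSum_sum fun m _ => hasSum_norm_sq (windowProj n m f))
    ((hasSum_norm_sq f).mul_left (n : ℝ))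
  have h (m : ℕ) : ‖windowProj n m f w‖ ^ 2 =
      if w.length ≤ m ∧ m < w.length + n then ‖f w‖ ^ 2 else 0 := by
    rw [windowProj_apply]
    split_ifs <;> simp
  simp only [h]
  rw [← Finset.sum_filter, Finset.sum_const, nsmul_eq_mul]
  refine mul_le_mul_of_nonneg_right ?_ (by positivity)
  have hsub : (Finset.range N).filter (fun m => w.length ≤ m ∧ m < w.length + n) ⊆
      Finset.Ico w.length (w.length + n) := fun m hm => by
    rw [Finset.mem_filter] at hm
    exact Finset.mem_Ico.2 hm.2
  have := Finset.card_le_card hsub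
  rw [Nat.card_Ico, Nat.add_sub_cancel_left] at this
  exact_mod_cast this

/-- The averages of the compressions of an operator to windows are bounded by its norm. -/
theorem norm_sum_windowProj_le (n N : ℕ) (T : PathHilbert V →L[ℂ] PathHilbert V) :
    ‖∑ m ∈ Finset.range N, windowProj n m * T * windowProj n m‖ ≤ n * ‖T‖ := by
  set B := ∑ m ∈ Finset.range N, windowProj n m * T * windowProj n m with hB
  refine ContinuousLinearMap.opNorm_le_bound _ (by positivity) fun f => ?_
  have key (g : PathHilbert V) : ‖⟪g, B f⟫_ℂ‖ ≤ n * ‖T‖ * ‖f‖ * ‖g‖ := by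
    have h1 : ⟪g, B f⟫_ℂ =
        ∑ m ∈ Finset.range N, ⟪windowProj n m g, T (windowProj n m f)⟫_ℂ := by
      rw [hB, _root_.sum_apply, inner_sum]
      exact Finset.sum_congr rfl fun m _ => inner_windowProj n m _ _
    have hs (h : PathHilbert V) : √(∑ m ∈ Finset.range N, ‖windowProj n m h‖ ^ 2) ≤ √n * ‖h‖ := by
      refine (Real.sqrt_le_sqrt (sum_norm_windowProj_sq_le n N h)).trans_eq ?_
      rw [Real.sqrt_mul (Nat.cast_nonneg n), Real.sqrt_sq (norm_nonneg h)]
    calc ‖⟪g, B f⟫_ℂ‖ ≤ ∑ m ∈ Finset.range N, ‖⟪windowProj n m g, T (windowProj n m f)⟫_ℂ‖ := by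
          rw [h1]
          exact norm_sum_le _ _
      _ ≤ ∑ m ∈ Finset.range N, ‖T‖ * (‖windowProj n m g‖ * ‖windowProj n m f‖) := by
          refine Finset.sum_le_sum fun m _ => (norm_inner_le_norm _ _).trans ?_
          have := T.le_opNorm (windowProj n m f)
          calc _ ≤ ‖windowProj n m g‖ * (‖T‖ * ‖windowProj n m f‖) :=
                mul_le_mul_of_nonneg_left this (norm_nonneg _)
            _ = _ := by ring
      _ ≤ ‖T‖ * ((√n * ‖g‖) * (√n * ‖f‖)) := by
          rw [← Finset.mul_sum]
          refine mul_le_mul_of_nonneg_left ?_ (norm_nonneg _)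
          refine (Real.sum_mul_le_sqrt_mul_sqrt _ _ _).trans ?_
          exact mul_le_mul (hs g) (hs f) (Real.sqrt_nonneg _) (by positivity)
      _ = n * ‖T‖ * ‖f‖ * ‖g‖ := by
          have := Real.mul_self_sqrt (Nat.cast_nonneg n : (0 : ℝ) ≤ n)
          linear_combination ‖T‖ * ‖g‖ * ‖f‖ * this
  have h2 := key (B f)
  rw [inner_self_eq_norm_sq_to_K] at h2
  simp only [Complex.coe_algebraMap, norm_pow, Complex.norm_real, norm_norm] at h2
  rcases eq_or_ne ‖B f‖ 0 with h0 | h0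
  · rw [h0]
    positivity
  · rw [sq] at h2
    exact le_of_mul_le_mul_right h2 (lt_of_le_of_ne (norm_nonneg _) h0.symm)

theorem windowProj_mul_mul_apply (n m : ℕ) (T : PathHilbert V →L[ℂ] PathHilbert V)
    (u w : PathSpace V) :
    (windowProj n m * T * windowProj n m : PathHilbert V →L[ℂ] PathHilbert V) (basisVec w) u =
      if (u.length ≤ m ∧ m < u.length + n) ∧ (w.length ≤ m ∧ m < w.length + n) then
        T (basisVec w) u else 0 := by
  have hw : windowProj n m (basisVec w) =
      if w.length ≤ m ∧ m < w.length + n then basisVec w else 0 := by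
    ext v
    rw [windowProj_apply]
    by_cases hv : v = w
    · subst hv
      split_ifs <;> rfl
    · rw [basisVec_apply_of_ne hv]
      split_ifs
      · exact (basisVec_apply_of_ne hv).symm
      · rfl
      · exact (basisVec_apply_of_ne hv).symm
      · rfl
  rw [mul_apply_eq_comp, mul_apply_eq_comp, windowProj_apply, hw]
  by_cases h1 : u.length ≤ m ∧ m < u.length + n <;> by_cases h2 : w.length ≤ m ∧ m < w.length + n
  · rw [if_pos h1, if_pos h2, if_pos ⟨h1, h2⟩]
  · rw [if_pos h1, if_neg h2, if_neg fun h => h2 h.2, map_zero]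
    rfl
  · rw [if_neg h1, if_neg fun h => h1 h.1]
  · rw [if_neg h1, if_neg fun h => h1 h.1]

end Window

theorem RightInvariant.apply_eq_zero_of_length_lt {T : PathHilbert V →L[ℂ] PathHilbert V}
    (hT : RightInvariant T) {u w : PathSpace V} (h : u.length < w.length) :
    T (basisVec w) u = 0 := by
  obtain ⟨s, x, p⟩ := w
  obtain ⟨s', y, u⟩ := u
  by_cases hs : s' = s
  · subst hs
    rw [hT.apply_basisVec_apply]
    refine extend_eq_zero _ _ _ fun g hg => ?_
    subst hg
    simp [PathSpace.length] at h
  · exact hT.apply_basisVec_apply_of_ne hs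

/-- The Fejér means of an operator. -/
theorem RightInvariant.exists_fejer {T : PathHilbert V →L[ℂ] PathHilbert V} (hT : RightInvariant T)
    {n : ℕ} (hn : 0 < n) : ∃ A : PathHilbert V →L[ℂ] PathHilbert V, ‖A‖ ≤ ‖T‖ ∧
      ∀ u w, A (basisVec w) u = ((n - (u.length - w.length) : ℕ) / n : ℂ) * T (basisVec w) u := by
  refine exists_operator_of_matrix
    (fun u w => ((n - (u.length - w.length) : ℕ) / n : ℂ) * T (basisVec w) u) ‖T‖ fun S => ?_
  -- Windows containing a path of `S` have index below `N`, so for `w` no longer than `u` exactly `n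
  -- - (|u| - |w|)` of them contain both.
  set N := S.sup PathSpace.length + n with hN
  refine ⟨(n : ℂ)⁻¹ • ∑ m ∈ Finset.range N, windowProj n m * T * windowProj n m, ?_, ?_⟩
  · rw [norm_smul, norm_inv, Complex.norm_natCast]
    have : (0 : ℝ) < n := by exact_mod_cast hn
    rw [inv_mul_le_iff₀ this]
    exact norm_sum_windowProj_le n N T
  · intro u hu w hw
    rcases lt_or_ge u.length w.length with hl | hl
    -- Truncated subtraction makes the weight `n / n` here, which is harmless since the entry of `T`
    -- is zero.
    · rw [hT.apply_eq_zero_of_length_lt hl, mul_zero]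
      change (n : ℂ)⁻¹ * (∑ m ∈ Finset.range N, windowProj n m * T * windowProj n m :
        PathHilbert V →L[ℂ] PathHilbert V) (basisVec w) u = 0
      rw [_root_.sum_apply, lp.coeFn_sum, Finset.sum_apply,
        Finset.sum_eq_zero, mul_zero]
      intro m _
      rw [windowProj_mul_mul_apply, hT.apply_eq_zero_of_length_lt hl, ite_self]
    · change (n : ℂ)⁻¹ * (∑ m ∈ Finset.range N, windowProj n m * T * windowProj n m :
        PathHilbert V →L[ℂ] PathHilbert V) (basisVec w) u = _
      rw [_root_.sum_apply, lp.coeFn_sum, Finset.sum_apply,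
        Finset.sum_congr rfl fun m _ => windowProj_mul_mul_apply n m T u w, ← Finset.sum_filter,
        Finset.sum_const]
      have hset : (Finset.range N).filter (fun m => (u.length ≤ m ∧ m < u.length + n) ∧
          (w.length ≤ m ∧ m < w.length + n)) = Finset.Ico u.length (w.length + n) := by
        have h1 : u.length ≤ S.sup PathSpace.length := Finset.le_sup hu
        have h2 : w.length ≤ S.sup PathSpace.length := Finset.le_sup hw
        ext m
        rw [Finset.mem_filter, Finset.mem_range, Finset.mem_Ico]
        omega
      rw [hset, Nat.card_Ico, nsmul_eq_mul,
        show w.length + n - u.length = n - (u.length - w.length) by omega]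
      ring

section PathSums

/-- `w` prolonged by `g` is `u`. -/
def IsProlongation (g w u : PathSpace V) : Prop :=
  ∃ (s x y : V) (p : Path s x) (v : Path x y),
    w = ⟨s, x, p⟩ ∧ g = ⟨x, y, v⟩ ∧ u = ⟨s, y, p.comp v⟩

theorem pathOp_basisVec_apply_of_isProlongation {g w u : PathSpace V} (h : IsProlongation g w u) :
    pathOp g.2.2 (basisVec w) u = 1 := by
  obtain ⟨s, x, y, p, v, rfl, rfl, rfl⟩ := h
  rw [pathOp_apply_comp, basisVec_apply_self]

theorem pathOp_basisVec_apply_of_not_isProlongation {g w u : PathSpace V}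
    (h : ¬IsProlongation g w u) : pathOp g.2.2 (basisVec w) u = 0 := by
  obtain ⟨x, y, v⟩ := g
  obtain ⟨s, x', p⟩ := w
  by_cases hx : x' = x
  · subst hx
    rw [pathOp_basisVec]
    refine basisVec_apply_of_ne fun hu => h ?_
    exact ⟨s, x', y, p, v, rfl, rfl, hu⟩
  · rw [pathOp_basisVec_of_ne (w := ⟨s, x', p⟩) _ hx]
    rfl

theorem IsProlongation.unique {g g' w u : PathSpace V} (h : IsProlongation g w u)
    (h' : IsProlongation g' w u) : g = g' := by
  obtain ⟨s, x, y, p, v, rfl, rfl, rfl⟩ := h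
  obtain ⟨s', x', y', p', v', hw, rfl, hu⟩ := h'
  obtain ⟨rfl, hw⟩ := Sigma.mk.inj hw
  obtain ⟨rfl, hw⟩ := Sigma.mk.inj (eq_of_heq hw)
  obtain rfl := eq_of_heq hw
  obtain ⟨rfl, hu⟩ := Sigma.mk.inj (eq_of_heq (Sigma.mk.inj hu).2)
  have hu := eq_of_heq hu
  rw [Path.comp_inj_right] at hu
  rw [hu]

theorem RightInvariant.apply_of_isProlongation {T : PathHilbert V →L[ℂ] PathHilbert V}
    (hT : RightInvariant T) {g w u : PathSpace V} (h : IsProlongation g w u) :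
    T (basisVec w) u = fourierCoeff T g := by
  obtain ⟨s, x, y, p, v, rfl, rfl, rfl⟩ := h
  rw [hT.apply_basisVec_apply, extend_comp_left]
  rfl

theorem RightInvariant.apply_of_not_isProlongation {T : PathHilbert V →L[ℂ] PathHilbert V}
    (hT : RightInvariant T) {w u : PathSpace V} (h : ∀ g, ¬IsProlongation g w u) :
    T (basisVec w) u = 0 := by
  obtain ⟨s, x, p⟩ := w
  obtain ⟨s', y, u⟩ := u
  by_cases hs : s' = s
  · subst hs
    rw [hT.apply_basisVec_apply]
    refine extend_eq_zero _ _ _ fun g hg => ?_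
    subst hg
    exact h ⟨x, y, g⟩ ⟨s', x, y, p, g, rfl, rfl, rfl⟩
  · exact hT.apply_basisVec_apply_of_ne hs

theorem IsProlongation.length_eq {g w u : PathSpace V} (h : IsProlongation g w u) :
    u.length = w.length + g.length := by
  obtain ⟨s, x, y, p, v, rfl, rfl, rfl⟩ := h
  exact Path.length_comp p v

/-- A path has at most one final segment of a given length, so the ranges of the `L_g` are
orthogonal. -/
theorem inner_pathOp_eq_zero {g g' : PathSpace V} (hne : g ≠ g') (hl : g.length = g'.length)
    (f f' : PathHilbert V) : ⟪pathOp g.2.2 f, pathOp g'.2.2 f'⟫_ℂ = 0 := by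
  obtain ⟨x, y, v⟩ := g
  obtain ⟨x', y', v'⟩ := g'
  rw [lp.inner_eq_tsum, ← tsum_zero (β := PathSpace V) (α := ℂ)]
  refine tsum_congr fun ⟨s, z, u⟩ => ?_
  by_cases hz : z = y
  · subst hz
    by_cases hz' : z = y'
    · subst hz'
      by_cases hu : ∃ p : Path s x, p.comp v = u
      · obtain ⟨p, rfl⟩ := hu
        have : pathOp v' f' ⟨s, z, p.comp v⟩ = 0 := by
          rw [pathOp_apply]
          refine extend_eq_zero _ _ _ fun q hq => hne ?_
          have hlen := congrArg Path.length hq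
          change v.length = v'.length at hl
          rw [Path.length_comp, Path.length_comp] at hlen
          obtain ⟨g, rfl, rfl⟩ := levi _ _ _ _ hq (by omega)
          rw [Path.length_comp] at hl
          obtain rfl := Path.eq_of_length_zero g (by omega)
          obtain rfl := Path.eq_nil_of_length_zero g (by omega)
          rw [Path.nil_comp]
        exact (congrArg _ this).trans (inner_zero_right _)
      · have : pathOp v f ⟨s, z, u⟩ = 0 := by
          rw [pathOp_apply]
          exact extend_eq_zero _ _ _ fun p hp => hu ⟨p, hp⟩
        exact (congrArg (fun c => ⟪c, pathOp v' f' ⟨s, z, u⟩⟫_ℂ) this).trans (inner_zero_left _)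
    · have : pathOp v' f' ⟨s, z, u⟩ = 0 := pathOp_apply_of_ne _ _ hz'
      exact (congrArg _ this).trans (inner_zero_right _)
  · have : pathOp v f ⟨s, z, u⟩ = 0 := pathOp_apply_of_ne _ _ hz
    exact (congrArg (fun c => ⟪c, pathOp v' f' ⟨s, z, u⟩⟫_ℂ) this).trans (inner_zero_left _)

theorem norm_sum_sq_of_orthogonal {E ι : Type*} [NormedAddCommGroup E] [InnerProductSpace ℂ E]
    (S : Finset ι) (v : ι → E) (h : ∀ i ∈ S, ∀ j ∈ S, i ≠ j → ⟪v i, v j⟫_ℂ = 0) :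
    ‖∑ i ∈ S, v i‖ ^ 2 = ∑ i ∈ S, ‖v i‖ ^ 2 := by
  classical
  induction S using Finset.induction_on with
  | empty => simp
  | insert i S hi ih =>
    rw [Finset.sum_insert hi, Finset.sum_insert hi, ← ih fun a ha b hb =>
      h a (Finset.mem_insert_of_mem ha) b (Finset.mem_insert_of_mem hb)]
    have h0 : ⟪v i, ∑ j ∈ S, v j⟫_ℂ = 0 := by
      rw [inner_sum]
      refine Finset.sum_eq_zero fun j hj => h i (Finset.mem_insert_self i S) j
        (Finset.mem_insert_of_mem hj) ?_
      rintro rfl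
      exact hi hj
    have := norm_add_sq_eq_norm_sq_add_norm_sq_of_inner_eq_zero (𝕜 := ℂ) _ _ h0
    simpa [sq] using this

/-- By Pythagoras a homogeneous sum is controlled by the `ℓ²` norm of its coefficients,
independently of the number of edges. -/
theorem norm_sum_smul_pathOp_le (k : ℕ) (S : Finset (PathSpace V)) (hS : ∀ g ∈ S, g.length = k)
    (b : PathSpace V → ℂ) {D : ℝ} (hD : 0 ≤ D) (hb : ∑ g ∈ S, ‖b g‖ ^ 2 ≤ D ^ 2) :
    ‖∑ g ∈ S, b g • pathOp g.2.2‖ ≤ D := by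
  refine ContinuousLinearMap.opNorm_le_bound _ hD fun f => ?_
  refine le_of_sq_le_sq ?_ (by positivity)
  rw [_root_.sum_apply, norm_sum_sq_of_orthogonal]
  · calc ∑ g ∈ S, ‖(b g • pathOp g.2.2) f‖ ^ 2 ≤ ∑ g ∈ S, ‖b g‖ ^ 2 * ‖f‖ ^ 2 := by
          refine Finset.sum_le_sum fun g _ => ?_
          change ‖b g • pathOp g.2.2 f‖ ^ 2 ≤ _
          rw [norm_smul, mul_pow]
          have : ‖pathOp g.2.2 f‖ ≤ ‖f‖ := by
            simpa using (pathOp g.2.2).le_of_opNorm_le (norm_pathOp_le _) f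
          gcongr
      _ ≤ (D * ‖f‖) ^ 2 := by
          rw [← Finset.sum_mul, mul_pow]
          exact mul_le_mul_of_nonneg_right hb (by positivity)
  · intro g hg g' hg' hne
    change ⟪b g • pathOp g.2.2 f, b g' • pathOp g'.2.2 f⟫_ℂ = 0
    rw [inner_smul_left, inner_smul_right, inner_pathOp_eq_zero hne ((hS g hg).trans (hS g' hg').symm),
      mul_zero, mul_zero]

/-- Coefficients with source `x` are coordinates of `T ξ_x`; summing over sources brings in the
number of vertices. -/
theorem sum_norm_fourierCoeff_sq_le [Finite V] (T : PathHilbert V →L[ℂ] PathHilbert V)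
    (S : Finset (PathSpace V)) : ∑ g ∈ S, ‖fourierCoeff T g‖ ^ 2 ≤ Nat.card V * ‖T‖ ^ 2 := by
  classical
  have := Fintype.ofFinite V
  rw [← Finset.sum_fiberwise S PathSpace.source, Nat.card_eq_fintype_card, ← nsmul_eq_mul,
    ← Finset.card_univ, ← Finset.sum_const]
  refine Finset.sum_le_sum fun x _ => ?_
  have h1 : ∑ g ∈ S with g.source = x, ‖fourierCoeff T g‖ ^ 2 =
      ∑ g ∈ S with g.source = x, ‖T (basisVec ⟨x, x, Path.nil⟩) g‖ ^ 2 := by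
    refine Finset.sum_congr rfl fun g hg => ?_
    obtain rfl := (Finset.mem_filter.1 hg).2
    rfl
  rw [h1]
  refine (sum_le_hasSum _ (fun _ _ => by positivity)
    (hasSum_norm_sq (T (basisVec ⟨x, x, Path.nil⟩)))).trans ?_
  have := T.le_opNorm (basisVec ⟨x, x, Path.nil⟩)
  rw [norm_basisVec, mul_one] at this
  gcongr

end PathSums

/-- The Fejér means of an invariant operator belong to the free semigroupoid algebra. -/
theorem RightInvariant.fejer_mem [Finite V] {T A : PathHilbert V →L[ℂ] PathHilbert V}
    (hT : RightInvariant T) {n : ℕ} (hA : ∀ u w, A (basisVec w) u =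
      ((n - (u.length - w.length) : ℕ) / n : ℂ) * T (basisVec w) u) :
    A ∈ leftFreeSemigroupoidAlgebra V := by
  classical
  let b (g : PathSpace V) : ℂ := ((n - g.length : ℕ) / n : ℂ) * fourierCoeff T g
  have hb (g : PathSpace V) : ‖b g‖ ≤ ‖fourierCoeff T g‖ := by
    rw [norm_mul]
    refine mul_le_of_le_one_left (norm_nonneg _) ?_
    rw [norm_div, Complex.norm_natCast, Complex.norm_natCast]
    refine div_le_one_of_le₀ ?_ (Nat.cast_nonneg n)
    exact_mod_cast Nat.sub_le _ _
  set D := √(Nat.card V * ‖T‖ ^ 2) with hD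
  -- A homogeneous layer may be an infinite sum, so finite partial sums are taken. They involve only
  -- `n` layers, each of norm at most `D`, and every matrix entry is eventually constant.
  refine mem_leftFreeSemigroupoidAlgebra_of_tendsto (l := atTop) (C := n * D)
    (A := fun S : Finset (PathSpace V) => ∑ g ∈ S, b g • pathOp g.2.2) (fun S => ?_) (fun S => ?_)
    fun u w => ?_
  · have h1 : ∑ g ∈ S, b g • pathOp g.2.2 =
        ∑ k ∈ Finset.range n, ∑ g ∈ S.filter (fun g => g.length < n) with g.length = k,
          b g • pathOp g.2.2 := by
      rw [Finset.sum_fiberwise_of_maps_to fun g hg => Finset.mem_range.2 (Finset.mem_filter.1 hg).2]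
      symm
      refine Finset.sum_subset (Finset.filter_subset _ _) fun g hg hg' => ?_
      have : n - g.length = 0 := by
        rw [Finset.mem_filter, not_and] at hg'
        have := hg' hg
        omega
      simp [b, this]
    rw [h1]
    refine (norm_sum_le _ _).trans ?_
    refine (Finset.sum_le_card_nsmul _ _ D fun k _ => ?_).trans (by simp)
    refine norm_sum_smul_pathOp_le k _ (fun g hg => (Finset.mem_filter.1 hg).2) b
      (Real.sqrt_nonneg _) ?_
    rw [hD, Real.sq_sqrt (by positivity)]
    refine (Finset.sum_le_sum fun g _ => ?_).trans (sum_norm_fourierCoeff_sq_le T _)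
    exact pow_le_pow_left₀ (norm_nonneg _) (hb g) 2
  · refine sum_mem fun g _ => ?_
    exact SMulMemClass.smul_mem _ (tensorAlgebra_le V (algebraicPart_le (pathOp_mem _)))
  · have hval (S : Finset (PathSpace V)) : (∑ g ∈ S, b g • pathOp g.2.2) (basisVec w) u =
        ∑ g ∈ S, b g * pathOp g.2.2 (basisVec w) u := by
      rw [_root_.sum_apply, lp.coeFn_sum, Finset.sum_apply]
      rfl
    simp only [hval]
    by_cases h : ∃ g, IsProlongation g w u
    · obtain ⟨g, hg⟩ := h
      refine tendsto_const_nhds.congr' ?_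
      filter_upwards [eventually_ge_atTop {g}] with S hS
      rw [Finset.sum_eq_single_of_mem g (hS (Finset.mem_singleton_self g)) fun g' _ hne => by
        rw [pathOp_basisVec_apply_of_not_isProlongation fun h' => hne (h'.unique hg), mul_zero],
        pathOp_basisVec_apply_of_isProlongation hg, mul_one, hA, hT.apply_of_isProlongation hg,
        hg.length_eq, Nat.add_sub_cancel_left]
    · push Not at h
      rw [hA, hT.apply_of_not_isProlongation h, mul_zero]
      refine tendsto_const_nhds.congr fun S => ?_
      rw [Finset.sum_eq_zero]
      exact fun g _ => by rw [pathOp_basisVec_apply_of_not_isProlongation (h g), mul_zero]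

/-- The Fejér means are bounded by `‖T‖`, and the weight of each fixed degree tends to 1. -/
theorem mem_of_rightInvariant [Finite V] {T : PathHilbert V →L[ℂ] PathHilbert V}
    (hT : RightInvariant T) : T ∈ leftFreeSemigroupoidAlgebra V := by
  choose A hA1 hA2 using fun n : ℕ => hT.exists_fejer (Nat.succ_pos n)
  refine mem_leftFreeSemigroupoidAlgebra_of_tendsto (l := atTop) hA1
    (fun n => hT.fejer_mem (hA2 n)) fun u w => ?_
  simp only [hA2]
  generalize u.length - w.length = d
  suffices h : Tendsto (fun n : ℕ => ((n + 1 - d : ℕ) / (n + 1 : ℕ) : ℂ)) atTop (𝓝 1) by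
    simpa using h.mul_const (T (basisVec w) u)
  have h1 : Tendsto (fun n : ℕ => 1 - (d : ℂ) * (1 / ((n : ℂ) + 1))) atTop (𝓝 (1 - d * 0)) :=
    (tendsto_one_div_add_atTop_nhds_zero_nat.const_mul _).const_sub _
  rw [mul_zero, sub_zero] at h1
  refine h1.congr' ?_
  filter_upwards [eventually_ge_atTop d] with n hn
  have h2 : ((n : ℂ) + 1) ≠ 0 := Nat.cast_add_one_ne_zero n
  rw [Nat.cast_sub (by omega)]
  push_cast
  field_simp

end Fejer

end FreeSemigroupoid

/-! ### From generators to the norm closure. -/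

section CommutatorDerivations

variable {E : Type*} [NormedRing E] [NormedAlgebra ℂ E]

theorem NonUnitalSubalgebra.exists_norm_coe_le {A B : NonUnitalSubalgebra ℂ E} (δ : A →L[ℂ] B) :
    ∃ K : ℝ, ∀ a, ‖(δ a : E)‖ ≤ K * ‖(a : E)‖ := by
  let d : A.toSubmodule →L[ℂ] E :=
    ⟨⟨⟨fun a => (δ a : E), fun a b => congrArg Subtype.val (δ.map_add a b)⟩,
      fun c a => congrArg Subtype.val (δ.map_smul c a)⟩, continuous_subtype_val.comp δ.continuous⟩
  exact ⟨‖d‖, fun a => d.le_opNorm a⟩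

theorem NonUnitalSubalgebra.coe_map_zero {A B : NonUnitalSubalgebra ℂ E} (δ : A →L[ℂ] B) :
    (δ 0 : E) = 0 := congrArg Subtype.val δ.map_zero

/-- If a bounded derivation on a norm closed algebra is implemented by `T` on a set of topological
generators, it is implemented by `T`. -/
theorem NonUnitalAlgebra.derivation_eq_commutator {S : Set E} {B : NonUnitalSubalgebra ℂ E}
    (δ : (NonUnitalAlgebra.adjoin ℂ S).topologicalClosure →L[ℂ] B)
    (hδ : ∀ a b, (δ (a * b) : E) = δ a * b + a * δ b) (T : E)
    (h : ∀ a : (NonUnitalAlgebra.adjoin ℂ S).topologicalClosure, (a : E) ∈ S →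
      (δ a : E) = a * T - T * a)
    (a : (NonUnitalAlgebra.adjoin ℂ S).topologicalClosure) : (δ a : E) = a * T - T * a := by
  have hle := (NonUnitalAlgebra.adjoin ℂ S).le_topologicalClosure
  have h1 : ∀ (b : E) (hb : b ∈ NonUnitalAlgebra.adjoin ℂ S),
      (δ ⟨b, hle hb⟩ : E) = b * T - T * b := by
    intro b hb
    induction hb using NonUnitalAlgebra.adjoin_induction with
    | mem b hb => exact h ⟨b, _⟩ hb
    | zero =>
      rw [zero_mul, mul_zero, sub_zero]
      exact NonUnitalSubalgebra.coe_map_zero δ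
    | add b b' hb hb' ih ih' =>
      refine (congrArg Subtype.val (δ.map_add ⟨b, hle hb⟩ ⟨b', hle hb'⟩)).trans ?_
      refine (congrArg₂ (· + ·) ih ih').trans ?_
      noncomm_ring
    | mul b b' hb hb' ih ih' =>
      refine (hδ ⟨b, hle hb⟩ ⟨b', hle hb'⟩).trans ?_
      rw [ih, ih']
      noncomm_ring
    | smul c b hb ih =>
      refine (congrArg Subtype.val (δ.map_smul c ⟨b, hle hb⟩)).trans ?_
      refine (congrArg (c • ·) ih).trans ?_
      rw [smul_sub, smul_mul_assoc, mul_smul_comm]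
  have hclosed : IsClosed {a | (δ a : E) = a * T - T * a} :=
    isClosed_eq (continuous_subtype_val.comp δ.continuous)
      ((continuous_subtype_val.mul continuous_const).sub
        (continuous_const.mul continuous_subtype_val))
  have hsub : {a : (NonUnitalAlgebra.adjoin ℂ S).topologicalClosure |
      (a : E) ∈ NonUnitalAlgebra.adjoin ℂ S} ⊆ {a | (δ a : E) = a * T - T * a} :=
    fun a ha => h1 a ha
  refine closure_minimal hsub hclosed (closure_subtype.2 ?_)
  have himg : Subtype.val '' {a : (NonUnitalAlgebra.adjoin ℂ S).topologicalClosure |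
      (a : E) ∈ NonUnitalAlgebra.adjoin ℂ S} = (NonUnitalAlgebra.adjoin ℂ S : Set E) := by
    ext b
    exact ⟨by rintro ⟨a, ha, rfl⟩; exact ha, fun hb => ⟨⟨b, hle hb⟩, hb, rfl⟩⟩
  rw [himg]
  exact a.2
end CommutatorDerivations

namespace FreeSemigroupoid

/-! ### The implementing operator. -/

noncomputable section Derivations

open scoped lp
open Quiver

variable {V : Type*} [Quiver V]

/-- The values of a bounded derivation on the operators `L_w`, the derivation vanishing on the
projections `L_x`. -/
structure IsPathDerivation (D : ∀ ⦃x y : V⦄, Path x y → PathHilbert V →L[ℂ] PathHilbert V) (K : ℝ) :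
    Prop where
  comp : ∀ ⦃x y z : V⦄ (w : Path x y) (v : Path y z),
    D (w.comp v) = D v * pathOp w + pathOp v * D w
  nil : ∀ x : V, D (Path.nil : Path x x) = 0
  rightInvariant : ∀ ⦃x y : V⦄ (w : Path x y), RightInvariant (D w)
  norm_le : ∀ ⦃x y : V⦄ (w : Path x y), ‖D w‖ ≤ K

namespace IsPathDerivation

variable {D : ∀ ⦃x y : V⦄, Path x y → PathHilbert V →L[ℂ] PathHilbert V} {K : ℝ}
  (hD : IsPathDerivation D K)
include hD

theorem mul_pathOp_nil {x y : V} (w : Path x y) : D w * pathOp (Path.nil : Path x x) = D w := by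
  have h := hD.comp Path.nil w
  rw [Path.nil_comp, hD.nil, mul_zero, add_zero] at h
  exact h.symm

theorem pathOp_nil_mul {x y : V} (w : Path x y) : pathOp (Path.nil : Path y y) * D w = D w := by
  have h := hD.comp w Path.nil
  rw [Path.comp_nil, hD.nil, zero_mul, zero_add] at h
  exact h.symm

theorem apply_basisVec_of_ne {x y : V} (w : Path x y) {p : PathSpace V} (hp : p.range ≠ x) :
    D w (basisVec p) = 0 := by
  rw [← hD.mul_pathOp_nil, mul_apply_eq_comp, pathOp_basisVec_of_ne _ hp, map_zero]

theorem apply_of_ne {x y : V} (w : Path x y) (f : PathHilbert V) {u : PathSpace V}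
    (hu : u.range ≠ y) : D w f u = 0 := by
  rw [← hD.pathOp_nil_mul, mul_apply_eq_comp]
  exact pathOp_apply_of_ne _ _ hu

/-- In the Leibniz rule at a vertex vector, `D v * pathOp w` puts `w` in front by right invariance,
while `pathOp v * D w` appends `v`. -/
theorem isPathCocycle : IsPathCocycle fun x y (w : Quiver.Path x y) (u : Quiver.Path x y) =>
    D w (basisVec ⟨x, x, Path.nil⟩) ⟨x, y, u⟩ := by
  intro x y z w v
  funext u
  change D (w.comp v) (basisVec ⟨x, x, Path.nil⟩) ⟨x, z, u⟩ = _
  rw [hD.comp, Pi.add_apply, ← rightOp_apply, ← pathOp_apply, ← (hD.rightInvariant v).apply_basisVec]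
  have h := pathOp_basisVec w (Path.nil : Path x x)
  rw [Path.nil_comp] at h
  rw [← h]
  rfl

theorem sum_norm_sq_le {x y : V} (w : Path x y) (S : Finset (Path x y)) :
    ∑ u ∈ S, ‖D w (basisVec ⟨x, x, Path.nil⟩) ⟨x, y, u⟩‖ ^ 2 ≤ K ^ 2 := by
  have hinj : Function.Injective fun u : Path x y => (⟨x, y, u⟩ : PathSpace V) := fun u u' h =>
    eq_of_heq (Sigma.mk.inj (eq_of_heq (Sigma.mk.inj h).2)).2
  set f := D w (basisVec ⟨x, x, Path.nil⟩) with hf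
  have h1 : ∑ u ∈ S, ‖f ⟨x, y, u⟩‖ ^ 2 = ∑ u ∈ S.map ⟨_, hinj⟩, ‖f u‖ ^ 2 := by
    rw [Finset.sum_map]
    rfl
  rw [h1]
  refine (sum_le_hasSum _ (fun _ _ => by positivity) (hasSum_norm_sq f)).trans ?_
  have := (D w).le_of_opNorm_le (hD.norm_le w) (basisVec ⟨x, x, Path.nil⟩)
  rw [norm_basisVec, mul_one] at this
  exact pow_le_pow_left₀ (norm_nonneg _) this 2

/-- A bounded derivation is implemented on the generators by an operator in the commutant of the
right multiplications. -/
theorem exists_implementing [Finite V] (hG : IsStronglyConnected V) :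
    ∃ T : PathHilbert V →L[ℂ] PathHilbert V, RightInvariant T ∧
      (∀ x : V, T * vertexOp x = vertexOp x * T) ∧
      ∀ ⦃x y : V⦄ (e : x ⟶ y), D e.toPath = T * edgeOp e - edgeOp e * T := by
  classical
  have := Fintype.ofFinite V
  obtain ⟨τ, hτ⟩ := hD.isPathCocycle.exists_potential (fun x y w S => hD.sum_norm_sq_le w S) hG
  obtain ⟨a, ha1, ha2⟩ : ∃ a : PathSpace V → PathSpace V → ℂ,
      (∀ (s x : V) (p : Path s x) (u : Path s x), a ⟨s, x, u⟩ ⟨s, x, p⟩ =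
        Function.extend (fun g : Path x x => p.comp g) (τ x) 0 u) ∧
      ∀ {s x s' x' : V} (u : Path s' x') (w : Path s x), s' ≠ s ∨ x' ≠ x →
        a ⟨s', x', u⟩ ⟨s, x, w⟩ = 0 := by
    -- The loop leading from `w` to `u` is unique by `IsProlongation.unique`, so the choice is
    -- immaterial.
    refine ⟨fun u w => if h : ∃ g : Σ x : V, Path x x, IsProlongation ⟨g.1, g.1, g.2⟩ w u then
      τ h.choose.1 h.choose.2 else 0, fun s x p u => ?_, fun {s0 x0 s1 x1} u w huw => ?_⟩
    · by_cases hu : ∃ g : Path x x, p.comp g = u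
      · obtain ⟨g, rfl⟩ := hu
        have hg : IsProlongation ⟨x, x, g⟩ ⟨s, x, p⟩ ⟨s, x, p.comp g⟩ :=
          ⟨s, x, x, p, g, rfl, rfl, rfl⟩
        have h : ∃ g' : Σ x : V, Path x x,
          IsProlongation ⟨g'.1, g'.1, g'.2⟩ ⟨s, x, p⟩ ⟨s, x, p.comp g⟩ := ⟨⟨x, g⟩, hg⟩
        refine (dif_pos h).trans ?_
        rw [extend_comp_left]
        have h' := h.choose_spec.unique hg
        generalize h.choose = k at h'
        obtain ⟨x', k⟩ := k
        obtain ⟨rfl, h'⟩ := Sigma.mk.inj h'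
        obtain rfl := eq_of_heq (Sigma.mk.inj (eq_of_heq h')).2
        rfl
      · rw [extend_eq_zero _ _ _ fun g hg => hu ⟨g, hg⟩]
        refine dif_neg ?_
        rintro ⟨⟨x', k⟩, s', x1, y1, p', v, hw, hk, hu'⟩
        obtain ⟨rfl, hw⟩ := Sigma.mk.inj hw
        obtain ⟨rfl, hw⟩ := Sigma.mk.inj (eq_of_heq hw)
        obtain rfl := eq_of_heq hw
        obtain ⟨rfl, hu'⟩ := Sigma.mk.inj (eq_of_heq (Sigma.mk.inj hu').2)
        exact hu ⟨v, (eq_of_heq hu').symm⟩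
    · refine dif_neg ?_
      rintro ⟨⟨x', k⟩, s', x1, y1, p', v, hw, hk, hu'⟩
      obtain ⟨rfl, hk⟩ := Sigma.mk.inj hk
      obtain ⟨rfl, -⟩ := Sigma.mk.inj (eq_of_heq hk)
      obtain ⟨rfl, hw⟩ := Sigma.mk.inj hw
      obtain ⟨rfl, -⟩ := Sigma.mk.inj (eq_of_heq hw)
      obtain ⟨rfl, hu'⟩ := Sigma.mk.inj hu'
      obtain ⟨rfl, -⟩ := Sigma.mk.inj (eq_of_heq hu')
      exact huw.elim (fun h => h rfl) fun h => h rfl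
  obtain ⟨T, -, hT⟩ := exists_operator_of_matrix a (∑ _x : V, K) fun S => by
    choose r v hv using fun x => hτ.approx x (S.sup PathSpace.length)
    -- If `D(v) = T L_v - L_v T`, then `-L_v^* D(v) = T - L_v^* T L_v` on paths ending at the source
    -- of `v`; `v` is chosen so that the last term has no entries between the paths in `S`. The
    -- summand at `x` sees only paths ending at `x`.
    refine ⟨-∑ x : V, copathOp (v x) * D (v x), ?_, fun u hu w hw => ?_⟩
    · rw [norm_neg]
      refine norm_sum_le_of_le _ fun x _ => ?_
      refine (norm_mul_le _ _).trans ?_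
      refine (mul_le_of_le_one_left (norm_nonneg _) (norm_copathOp_le _)).trans (hD.norm_le _)
    · change -(∑ x : V, copathOp (v x) * D (v x) : PathHilbert V →L[ℂ] PathHilbert V)
        (basisVec w) u = _
      obtain ⟨s, x, p⟩ := w
      rw [_root_.sum_apply, lp.coeFn_sum, Finset.sum_apply, Finset.sum_eq_single x]
      · rw [mul_apply_eq_comp]
        obtain ⟨s', x', q⟩ := u
        by_cases hx : x' = x
        · subst hx
          rw [copathOp_apply]
          by_cases hs : s' = s
          · subst hs
            rw [ha1, (hD.rightInvariant _).apply_basisVec_apply]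
            exact hv x' q p (Finset.le_sup (f := PathSpace.length) hu)
              (Finset.le_sup (f := PathSpace.length) hw)
          · rw [ha2 _ _ (Or.inl hs), (hD.rightInvariant _).apply_basisVec_apply_of_ne (w := ⟨_, _, _⟩)
            (u := ⟨_, _, _⟩) hs, neg_zero]
        · rw [ha2 _ _ (Or.inr hx), copathOp_apply_of_ne (u := ⟨s', x', q⟩) _ _ hx, neg_zero]
      · intro x' _ hx'
        rw [mul_apply_eq_comp, hD.apply_basisVec_of_ne _ (p := ⟨s, x, p⟩) hx'.symm, map_zero]
        rfl
      · simp
  have hTinv : RightInvariant T := by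
    refine rightInvariant_of_apply (fun w u h => (hT _ _).trans (ha2 u.2.2 w.2.2 (Or.inl h)))
      (fun x y g => a ⟨x, y, g⟩ ⟨x, x, Path.nil⟩) fun s x y p u => ?_
    rw [hT]
    by_cases hy : y = x
    · subst hy
      rw [ha1]
      congr 1
      funext g
      rw [ha1]
      have := extend_comp_left (Path.nil : Path y y) (τ y) g
      rw [Path.nil_comp] at this
      exact this.symm
    · rw [ha2 _ _ (Or.inr hy)]
      by_cases hu : ∃ g : Path x y, p.comp g = u
      · obtain ⟨g, rfl⟩ := hu
        rw [extend_comp_left, ha2 _ _ (Or.inr hy)]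
      · exact (extend_eq_zero _ _ _ fun g hg => hu ⟨g, hg⟩).symm
  refine ⟨T, hTinv, fun x => ?_, fun x y e => ?_⟩
  · rw [← pathOp_nil]
    refine ext_basisVec fun ⟨s, t, p⟩ => ?_
    rw [mul_apply_eq_comp, mul_apply_eq_comp]
    ext ⟨s', t', q⟩
    by_cases ht : t = x
    · subst ht
      rw [pathOp_basisVec, Path.comp_nil]
      by_cases ht' : t' = t
      · subst ht'
        exact (pathOp_apply_comp Path.nil _ q).symm
      · rw [hT, ha2 _ _ (Or.inr ht')]
        exact (pathOp_apply_of_ne (u := ⟨s', t', q⟩) _ _ ht').symm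
    · rw [pathOp_basisVec_of_ne (w := ⟨s, t, p⟩) _ ht, map_zero]
      by_cases ht' : t' = x
      · subst ht'
        have h1 := pathOp_apply_comp Path.nil (T (basisVec ⟨s, t, p⟩)) q
        rw [Path.comp_nil] at h1
        rw [h1, hT, ha2 _ _ (Or.inr fun h => ht h.symm)]
        rfl
      · exact (pathOp_apply_of_ne (u := ⟨s', t', q⟩) _ _ ht').symm
  · rw [← pathOp_toPath]
    refine (hD.rightInvariant _).ext ((hTinv.mul (rightInvariant_pathOp _)).sub
      ((rightInvariant_pathOp _).mul hTinv)) fun z => ?_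
    ext ⟨s, t, u⟩
    change D e.toPath (basisVec ⟨z, z, Path.nil⟩) ⟨s, t, u⟩ =
      T (pathOp e.toPath (basisVec ⟨z, z, Path.nil⟩)) ⟨s, t, u⟩ -
        pathOp e.toPath (T (basisVec ⟨z, z, Path.nil⟩)) ⟨s, t, u⟩
    by_cases hz : z = x
    · subst hz
      rw [pathOp_basisVec, Path.nil_comp, hT]
      by_cases ht : t = y
      · subst ht
        rw [pathOp_apply]
        by_cases hs : s = z
        · subst hs
          rw [ha1]
          have h1 : (fun p : Path s s => T (basisVec ⟨s, s, Path.nil⟩) ⟨s, s, p⟩) = τ s := by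
            funext g
            rw [hT, ha1]
            have := extend_comp_left (Path.nil : Path s s) (τ s) g
            rwa [Path.nil_comp] at this
          rw [h1]
          exact hτ.edge e u
        · rw [(hD.rightInvariant _).apply_basisVec_apply_of_ne (w := ⟨_, _, _⟩)
            (u := ⟨_, _, _⟩) hs, ha2 _ _ (Or.inl hs)]
          have h1 : (fun p : Path s z => T (basisVec ⟨z, z, Path.nil⟩) ⟨s, z, p⟩) = 0 := by
            funext g
            rw [hT, ha2 _ _ (Or.inl hs)]
            rfl
          rw [h1, zero_sub, zero_eq_neg]
          by_cases hu : ∃ g : Path s z, g.comp e.toPath = u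
          · obtain ⟨g, rfl⟩ := hu
            rw [extend_comp_right]
            rfl
          · exact extend_eq_zero _ _ _ fun g hg => hu ⟨g, hg⟩
      · rw [hD.apply_of_ne (u := ⟨s, t, u⟩) _ _ ht, ha2 _ _ (Or.inr ht),
          pathOp_apply_of_ne (u := ⟨s, t, u⟩) _ _ ht, sub_zero]
    · rw [hD.apply_basisVec_of_ne (p := ⟨z, z, Path.nil⟩) _ hz,
        pathOp_basisVec_of_ne (w := ⟨z, z, Path.nil⟩) _ hz, map_zero]
      have h2 : pathOp e.toPath (T (basisVec ⟨z, z, Path.nil⟩)) ⟨s, t, u⟩ = 0 := by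
        by_cases ht : t = y
        · subst ht
          rw [pathOp_apply]
          have h1 : (fun p : Path s x => T (basisVec ⟨z, z, Path.nil⟩) ⟨s, x, p⟩) = 0 := by
            funext g
            rw [hT, ha2 _ _ (Or.inr fun h => hz h.symm)]
            rfl
          rw [h1]
          by_cases hu : ∃ g : Path s x, g.comp e.toPath = u
          · obtain ⟨g, rfl⟩ := hu
            rw [extend_comp_right]
            rfl
          · exact extend_eq_zero _ _ _ fun g hg => hu ⟨g, hg⟩
        · exact pathOp_apply_of_ne _ _ ht
      rw [h2]
      exact (sub_zero _).symm

end IsPathDerivation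

theorem vertexOp_mul_self (x : V) : vertexOp x * vertexOp x = vertexOp x := by
  rw [← pathOp_nil, ← pathOp_comp, Path.comp_nil]

theorem vertexOp_mul_of_ne {x y : V} (h : x ≠ y) : vertexOp x * vertexOp y = 0 := by
  refine ext_basisVec fun w => ?_
  rw [mul_apply_eq_comp]
  by_cases hw : w.range = y
  · subst hw
    rw [vertexOp_basisVec, vertexOp_basisVec_of_ne h.symm]
    rfl
  · rw [vertexOp_basisVec_of_ne hw, map_zero]
    rfl

theorem sum_vertexOp [Fintype V] : ∑ x : V, vertexOp x = 1 := by
  classical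
  refine ext_basisVec fun w => ?_
  rw [_root_.sum_apply, Finset.sum_eq_single w.range, vertexOp_basisVec]
  · rfl
  · exact fun x _ hx => vertexOp_basisVec_of_ne hx.symm
  · simp

/-- A bounded derivation from the tensor algebra to the left free semigroupoid algebra of a strongly
connected graph with finitely many vertices is inner. -/
theorem IsDerivation.isInner [Finite V] (hG : IsStronglyConnected V)
    {δ : tensorAlgebra V →L[ℂ] leftFreeSemigroupoidAlgebra V} (hδ : IsDerivation δ) :
    IsInner δ := by
  classical
  have := Fintype.ofFinite V
  let L {x y : V} (w : Path x y) : tensorAlgebra V := ⟨pathOp w, algebraicPart_le (pathOp_mem w)⟩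
  let d (A : tensorAlgebra V) : PathHilbert V →L[ℂ] PathHilbert V := δ A
  have hLcomp {x y z : V} (w : Path x y) (v : Path y z) : L (w.comp v) = L v * L w :=
    Subtype.ext (pathOp_comp w v)
  let p (x : V) : tensorAlgebra V := L (Path.nil : Path x x)
  have hpp (x : V) : p x * p x = p x := (hLcomp _ _).symm
  have hpne {x y : V} (h : x ≠ y) : p x * p y = 0 := by
    refine Subtype.ext ?_
    change pathOp _ * pathOp _ = 0
    rw [pathOp_nil, pathOp_nil, vertexOp_mul_of_ne h]
  have hpcoe (x : V) : (p x : PathHilbert V →L[ℂ] PathHilbert V) = vertexOp x := pathOp_nil x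
  -- The `p_x` are orthogonal idempotents with sum 1, so the Leibniz rule gives `δ(p_y) = T0 p_y -
  -- p_y T0`.
  set T0 : PathHilbert V →L[ℂ] PathHilbert V := ∑ x : V, d (p x) * vertexOp x with hT0
  have hT0mem : T0 ∈ leftFreeSemigroupoidAlgebra V :=
    sum_mem fun x _ => mul_mem (δ (p x)).2 (hpcoe x ▸ tensorAlgebra_le V (p x).2)
  have hd (A B : tensorAlgebra V) : d (A * B) = d A * B + A * d B := hδ A B
  have hd0 : d 0 = 0 := NonUnitalSubalgebra.coe_map_zero δ
  obtain ⟨K, hK⟩ := NonUnitalSubalgebra.exists_norm_coe_le δ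
  have hvert (y : V) : d (p y) + vertexOp y * T0 - T0 * vertexOp y = 0 := by
    have h1 : T0 * vertexOp y = d (p y) * vertexOp y := by
      rw [hT0, Finset.sum_mul, Finset.sum_eq_single y]
      · rw [mul_assoc, vertexOp_mul_self]
      · intro x _ hx
        rw [mul_assoc, vertexOp_mul_of_ne hx, mul_zero]
      · simp
    have h2 : vertexOp y * T0 = d (p y) * vertexOp y - d (p y) := by
      have h3 (x : V) : vertexOp y * (d (p x) * vertexOp x) =
          d (p y * p x) * vertexOp x - d (p y) * vertexOp x := by
        rw [hd, hpcoe, hpcoe, add_mul, mul_assoc (d (p y)), vertexOp_mul_self, mul_assoc]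
        abel
      rw [hT0, Finset.mul_sum, Finset.sum_congr rfl fun x _ => h3 x, Finset.sum_sub_distrib,
        ← Finset.mul_sum, sum_vertexOp, mul_one, Finset.sum_eq_single y]
      · rw [hpp]
      · intro x _ hx
        rw [hpne hx.symm, hd0, zero_mul]
      · simp
    rw [h1, h2]
    abel
  have hD : IsPathDerivation (fun x y (w : Quiver.Path x y) => d (L w) + pathOp w * T0 - T0 * pathOp w)
      (|K| + ‖T0‖ + ‖T0‖) := by
    refine ⟨fun x y z w v => ?_, fun x => ?_, fun x y w => ?_, fun x y w => ?_⟩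
    · rw [hLcomp, hd, pathOp_comp]
      change d (L v) * pathOp w + pathOp v * d (L w) + _ - _ = _
      noncomm_ring
    · simp only [pathOp_nil]
      exact hvert x
    · exact ((rightInvariant_of_mem (δ (L w)).2).add ((rightInvariant_pathOp w).mul
        (rightInvariant_of_mem hT0mem))).sub
        ((rightInvariant_of_mem hT0mem).mul (rightInvariant_pathOp w))
    · have h1 : ‖d (L w)‖ ≤ |K| := by
        refine (hK (L w)).trans ((mul_le_mul_of_nonneg_right (le_abs_self K) (norm_nonneg _)).trans ?_)
        exact mul_le_of_le_one_right (abs_nonneg _) (norm_pathOp_le w)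
      have h2 : ‖pathOp w * T0‖ ≤ ‖T0‖ :=
        (norm_mul_le _ _).trans (mul_le_of_le_one_left (norm_nonneg _) (norm_pathOp_le w))
      have h3 : ‖T0 * pathOp w‖ ≤ ‖T0‖ :=
        (norm_mul_le _ _).trans (mul_le_of_le_one_right (norm_nonneg _) (norm_pathOp_le w))
      refine (norm_sub_le _ _).trans (add_le_add ((norm_add_le _ _).trans (add_le_add h1 h2)) h3)
  obtain ⟨T1, hT1, hT1v, hT1e⟩ := hD.exists_implementing hG
  -- On edges `δ(A) + A T0 - T0 A = T1 A - A T1`, so both operators enter with a minus sign.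
  refine ⟨⟨-T1 - T0, sub_mem (neg_mem (mem_of_rightInvariant hT1)) hT0mem⟩,
    NonUnitalAlgebra.derivation_eq_commutator δ hδ _ fun A hA => ?_⟩
  obtain ⟨x, y, e, hA⟩ | ⟨x, hA⟩ := hA
  · obtain rfl : A = L e.toPath := Subtype.ext (hA.trans (pathOp_toPath e).symm)
    have h := hT1e e
    rw [pathOp_toPath] at h
    rw [hA]
    change d (L e.toPath) = _
    rw [eq_sub_of_add_eq (eq_add_of_sub_eq h)]
    noncomm_ring
  · obtain rfl : A = p x := Subtype.ext (hA.trans (hpcoe x).symm)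
    have h := hvert x
    rw [hA]
    change d (p x) = _
    rw [eq_sub_of_add_eq (sub_eq_zero.1 h), mul_sub, sub_mul, mul_neg, neg_mul, hT1v x]
    abel

end Derivations

end FreeSemigroupoid

theorem mainTheorem9 (V : Type*) [Quiver V] [Finite V] (hG : Quiver.IsStronglyConnected V)
    (δ : FreeSemigroupoid.tensorAlgebra V →L[ℂ] FreeSemigroupoid.leftFreeSemigroupoidAlgebra V)
    (hδ : FreeSemigroupoid.IsDerivation δ) : FreeSemigroupoid.IsInner δ :=
  FreeSemigroupoid.IsDerivation.isInner hG hδ
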